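/- For $k,n\in\{1,2,\dots\}$ let $a_n^k=\exp\bigl(-\bigl(\tfrac{(n+k)(n+k+1)}{2}+k\bigr)^2\bigr)$, and let $S^2$ be the unit sphere of $\mathbb R^3$. Call a sequence $(S_k)_{k\ge1}$ of finite subsets of $S^2$, together with a point $v_\infty\in S^2$, \emph{admissible with constant $c>0$} if for all $k\ge 1$: $\# S_k=k^2$; $\operatorname{diam}S_k\le 1/k^2$; $d(u,w)\ge c/k^3$ for all distinct $u,w\in S_k$; $d(u,w)\ge c/k^3$ for all $u\in S_k$, $w\in S_h$, $h>k$; and if $S_k\to S_\infty:=\{v_\infty\}$ in the Hausdorff distance as $k\to\infty$. Given such a sequence, put $$F=\overline{\bigcup_{k\ge1}\{a_n^k v: v\in S_k,\ n\ge1\}}\subset\mathbb R^3 ,$$ a closed set containing $0$, regarded as a metric space with the Euclidean distance. For a metric space $(X,d)$, let $B(x,r)$ and $\overline B(x,r)$ denote open and closed balls, and let $n(r,E)$ be the minimum number of open balls of radius $r$ needed to cover $E\subset X$. For $x\in X$ put $$\overline\delta_X(x)=\limsup_{\lambda\to0}\limsup_{r\to0}\frac{\log n(\lambda r,\overline B(x,r))}{\log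 1/\lambda},$$ $$\underline d(X)=\lim_{R\to\infty}\liminf_{r\to0}\frac{\log n(r,B(x,R))}{\log 1/r},\qquad \overline d(X)=\lim_{R\to\infty}\limsup_{r\to0}\frac{\log n(r,B(x,R))}{\log 1/r}.$$ The tangent cone $\mathcal T_xX$ is the set of (isometry classes of) proper pointed metric spaces that are limit points of $(X,td,x)$ as $t\to\infty$ in the pointed Gromov--Hausdorff topology; its elements are the tangent sets of $X$ at $x$. \textbf{Proposition.} Admissible sequences exist for some constant $c>0$. For every $c>0$ and every sequence admissible with constant $c$, the set $F$ has the following properties. \begin{enumerate} \item Up to isometry of pointed spaces, the tangent sets of $F$ at $0$ are exactly the dilations by factors $\alpha>0$ of $\{0\}$, of $S_k\cup\{0\}$, $k\ge1$, and of $S_\infty\cup\{0\}$, all with base point $0$. \item Every $T\in\mathcal T_0F$ satisfies $\underline d(T)=\overline d(T)=0$; in particular $\sup_{T\in\mathcal T_0F}\underline d(T)=\sup_{T\in\mathcal T_0F}\overline d(T)=0$. \item $\overline\delta_F(0)\ge\frac12$; in particular $\overline\delta_F(0)>\sup_{T\in\mathcal T_0F}\overline d(T)=0$. \item $F$ satisfies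 the compactness condition $\limsup_{r\to0}n(\lambda r,\overline B(0,r))<\infty$ for all $\lambda>0$, but it does not satisfy the uniformity assumption at $0$: there are no constants $c'\ge1$, $a\in(0,1]$ such that $n(\lambda\mu r,B(y,\lambda r))\le c'\,n(\lambda\mu r,B(z,\lambda r))$ for all $0<r\le a$, $0<\lambda,\mu\le1$, $y,z\in B(0,r)$. \end{enumerate} Hence the formula $\overline\delta_X(x)=\sup_{T\in\mathcal T_xX}\underline d(T)=\sup_{T\in\mathcal T_xX}\overline d(T)$, which holds under the compactness condition and the uniformity assumption, fails for $X=F$, $x=0$, where only the uniformity assumption is missing. -/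

import Mathlib

open Filter Topology Metric Set
open scoped ENNReal

/-! ### Covering numbers and dimensions -/

/-- `n(r, E)`: the minimum number of open balls of radius `r` (centred anywhere in the
ambient metric space) needed to cover `E`; it is `⊤` if no finite cover exists. -/
noncomputable def openCoveringNumber {X : Type*} [MetricSpace X] (r : ℝ) (E : Set X) : ℕ∞ :=
  ⨅ (s : Finset X) (_ : E ⊆ ⋃ y ∈ s, ball y r), (s.card : ℕ∞)

/-- `log n(r, E)` as an extended real number. -/
noncomputable def logCovering {X : Type*} [MetricSpace X] (r : ℝ) (E : Set X) : EReal :=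
  ENNReal.log ((openCoveringNumber r E : ℕ∞) : ℝ≥0∞)

/-- The upper tangential dimension of `E ⊆ X` at `x`:
`limsup_{l → 0} limsup_{r → 0} log n(l r, E ∩ closedBall x r) / log (1 / l)`. -/
noncomputable def upperTangentialDim {X : Type*} [MetricSpace X] (E : Set X) (x : X) : EReal :=
  limsup (fun l : ℝ =>
    limsup (fun r : ℝ =>
      logCovering (l * r) (E ∩ closedBall x r) / ((Real.log (1 / l) : ℝ) : EReal))
    (𝓝[>] 0)) (𝓝[>] 0)

/-- The lower box dimension of `X`, computed with the base point `x`: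
`lim_{R → ∞} liminf_{r → 0} log n(r, B(x, R)) / log (1 / r)`.  The expression under the limit is
nondecreasing in `R`, so that the limit exists and is the `limsup`. -/
noncomputable def lowerBoxDim {X : Type*} [MetricSpace X] (x : X) : EReal :=
  limsup (fun R : ℝ =>
    liminf (fun r : ℝ => logCovering r (ball x R) / ((Real.log (1 / r) : ℝ) : EReal))
    (𝓝[>] 0)) atTop

/-- The upper box dimension of `X`, computed with the base point `x`:
`lim_{R → ∞} limsup_{r → 0} log n(r, B(x, R)) / log (1 / r)`.  The expression under the limit is
nondecreasing in `R`, so that the limit exists and is the `limsup`. -/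
noncomputable def upperBoxDim {X : Type*} [MetricSpace X] (x : X) : EReal :=
  limsup (fun R : ℝ =>
    limsup (fun r : ℝ => logCovering r (ball x R) / ((Real.log (1 / r) : ℝ) : EReal))
    (𝓝[>] 0)) atTop

/-- The compactness condition at `x`: `limsup_{r → 0} n(l r, closedBall x r) < ∞` for all
`l > 0`. -/
def TangentCompactnessCondition {X : Type*} [MetricSpace X] (x : X) : Prop :=
  ∀ l : ℝ, 0 < l →
    limsup (fun r : ℝ => openCoveringNumber (l * r) (closedBall x r)) (𝓝[>] 0) < ⊤

/-- The uniformity assumption at `x`: there are constants `c ≥ 1` and `a ∈ (0, 1]` such that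
`n(l m r, B(y, l r)) ≤ c n(l m r, B(z, l r))` for all `r ≤ a`, `l, m ≤ 1`, `y, z ∈ B(x, r)`. -/
def UniformityAssumption {X : Type*} [MetricSpace X] (x : X) : Prop :=
  ∃ c a : ℝ, 1 ≤ c ∧ 0 < a ∧ a ≤ 1 ∧
    ∀ r l m : ℝ, 0 < r → r ≤ a → 0 < l → l ≤ 1 → 0 < m → m ≤ 1 →
      ∀ y ∈ ball x r, ∀ z ∈ ball x r,
        ((openCoveringNumber (l * m * r) (ball y (l * r)) : ℕ∞) : ℝ≥0∞) ≤
          ENNReal.ofReal c * ((openCoveringNumber (l * m * r) (ball z (l * r)) : ℕ∞) : ℝ≥0∞)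

/-! ### Pointed metric spaces and tangent sets -/

/-- A pointed metric space.  A proper metric space has at most continuum many points, so every
isometry class of proper pointed metric spaces has a representative in `Type`. -/
structure PointedMetricSpace where
  carrier : Type
  [metric : MetricSpace carrier]
  pt : carrier

attribute [instance] PointedMetricSpace.metric

/-- The rescaled pointed metric space `(X, t d, x)`. -/
noncomputable def PointedMetricSpace.dilate (X : PointedMetricSpace) (t : ℝ) (ht : 0 < t) :
    PointedMetricSpace where
  carrier := X.carrier
  metric :=
    { dist := fun a b => t * dist a b
      dist_self := fun a => by simp
      dist_comm := fun a b => by rw [dist_comm]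
      dist_triangle := fun a b c => by
        have h := mul_le_mul_of_nonneg_left (dist_triangle a b c) ht.le
        linarith [mul_add t (dist a b) (dist b c)]
      eq_of_dist_eq_zero := fun {a b} h => by
        have h' : t * dist a b = 0 := h
        exact dist_eq_zero.mp ((mul_eq_zero.mp h').resolve_left ht.ne') }
  pt := X.pt

/-- A subset `A` of a metric space with a distinguished point, as a pointed metric space. -/
def PointedMetricSpace.ofSet {X : Type} [MetricSpace X] (A : Set X) (x : X) (hx : x ∈ A) :
    PointedMetricSpace where
  carrier := A
  pt := ⟨x, hx⟩

/-- Isometry of pointed metric spaces. -/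
def PointedMetricSpace.IsIsometricTo (X Y : PointedMetricSpace) : Prop :=
  ∃ e : X.carrier ≃ᵢ Y.carrier, e X.pt = Y.pt

/-- `X` and `Y` have isometric embeddings into a common metric space for which the base points
are `ε`-close and the closed `R`-ball about the base point of each of the two spaces lies in the
`ε`-neighbourhood of the other space. -/
def PointedMetricSpace.PGHClose (R ε : ℝ) (X Y : PointedMetricSpace) : Prop :=
  ∃ (Z : Type) (_ : MetricSpace Z) (φ : X.carrier → Z) (ψ : Y.carrier → Z),
    Isometry φ ∧ Isometry ψ ∧ dist (φ X.pt) (ψ Y.pt) < ε ∧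
    φ '' closedBall X.pt R ⊆ thickening ε (range ψ) ∧
    ψ '' closedBall Y.pt R ⊆ thickening ε (range φ)

/-- The tangent cone of `X` at its base point: the proper pointed metric spaces that are limit
points, as `t → ∞`, of `(X, t d, x)` in the pointed Gromov-Hausdorff topology, a neighbourhood
base of which at `T` is given by the sets `{Y | PGHClose R ε T Y}`, `R, ε > 0`. -/
def tangentCone (X : PointedMetricSpace) : Set PointedMetricSpace :=
  {T | ProperSpace T.carrier ∧
    ∀ R ε : ℝ, 0 < R → 0 < ε →
      ∃ᶠ t : ℝ in atTop, ∃ ht : 0 < t, PointedMetricSpace.PGHClose R ε T (X.dilate t ht)}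

/-! ### The set `F` -/

/-- Three-dimensional Euclidean space. -/
abbrev E3 : Type := EuclideanSpace ℝ (Fin 3)

/-- The radii `a_n^k = exp (-((n + k)(n + k + 1) / 2 + k)²)`. -/
noncomputable def radiusSeq (k n : ℕ) : ℝ :=
  Real.exp (-((((n : ℝ) + k) * ((n : ℝ) + k + 1) / 2 + k) ^ 2))

/-- The conditions on the finite subsets `S k`, `k ≥ 1`, of the unit sphere. -/
structure IsAdmissible (c : ℝ) (S : ℕ → Finset E3) (v : E3) : Prop where
  subset_sphere : ∀ k, 1 ≤ k → (S k : Set E3) ⊆ sphere 0 1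
  card_eq : ∀ k, 1 ≤ k → (S k).card = k ^ 2
  diam_le : ∀ k, 1 ≤ k → diam (S k : Set E3) ≤ 1 / (k : ℝ) ^ 2
  separated : ∀ k, 1 ≤ k → ∀ u ∈ S k, ∀ w ∈ S k, u ≠ w → c / (k : ℝ) ^ 3 ≤ dist u w
  cross_separated : ∀ k h, 1 ≤ k → k < h → ∀ u ∈ S k, ∀ w ∈ S h, c / (k : ℝ) ^ 3 ≤ dist u w
  limit_mem : v ∈ sphere (0 : E3) 1
  tendsto : Tendsto (fun k => hausdorffDist (S k : Set E3) {v}) atTop (𝓝 0)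

/-- `F`, the closure of the union over `k ≥ 1` of `A_k = {a_n^k v : v ∈ S_k, n ≥ 1}`. -/
def setF (S : ℕ → Finset E3) : Set E3 :=
  closure {x | ∃ k n : ℕ, 1 ≤ k ∧ 1 ≤ n ∧ ∃ v ∈ S k, x = radiusSeq k n • v}

theorem tendsto_radiusSeq (k : ℕ) : Tendsto (radiusSeq k) atTop (𝓝 0) := by
  unfold radiusSeq
  refine Real.tendsto_exp_atBot.comp (tendsto_neg_atTop_atBot.comp ?_)
  refine tendsto_atTop_mono (fun n => ?_) (tendsto_natCast_atTop_atTop (R := ℝ))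
  have hn : (0 : ℝ) ≤ n := n.cast_nonneg
  have hk : (0 : ℝ) ≤ k := k.cast_nonneg
  rcases Nat.eq_zero_or_pos n with h | h
  · subst h
    simpa using sq_nonneg _
  · have h1 : (1 : ℝ) ≤ n := by exact_mod_cast h
    have h2 : (n : ℝ) ≤ ((n : ℝ) + k) * ((n : ℝ) + k + 1) / 2 + k := by
      nlinarith [mul_nonneg hn hk]
    nlinarith

theorem IsAdmissible.zero_mem {c : ℝ} {S : ℕ → Finset E3} {v : E3} (h : IsAdmissible c S v) :
    (0 : E3) ∈ setF S := by
  have hne : (S 1).Nonempty := by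
    rw [← Finset.card_pos, h.card_eq 1 le_rfl]
    norm_num
  obtain ⟨w, hw⟩ := hne
  have ht : Tendsto (fun n => radiusSeq 1 n • w) atTop (𝓝 0) := by
    simpa using (tendsto_radiusSeq 1).smul_const w
  refine mem_closure_of_tendsto ht ?_
  filter_upwards [eventually_ge_atTop 1] with n hn
  exact ⟨1, n, le_rfl, hn, w, hw, rfl⟩

/-- The pointed metric space `(F, 0)`. -/
noncomputable def pointedF {c : ℝ} {S : ℕ → Finset E3} {v : E3} (h : IsAdmissible c S v) :
    PointedMetricSpace :=
  PointedMetricSpace.ofSet (setF S) 0 h.zero_mem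

/-- The sets `{0}`, `S_k ∪ {0}` for `k ≥ 1`, and `S_∞ ∪ {0}` where `S_∞ = {v}`. -/
inductive IsTangentModel (S : ℕ → Finset E3) (v : E3) : Set E3 → Prop
  | zero : IsTangentModel S v {0}
  | finite (k : ℕ) (hk : 1 ≤ k) : IsTangentModel S v (insert 0 (S k : Set E3))
  | infinite : IsTangentModel S v (insert 0 {v})

/-!
At the scale `t = 1 / a_n^k` the set `t F` has the layer `S_k` on the unit sphere. The exponents
`(n + k)(n + k + 1) / 2 + k` are distinct integers for distinct pairs `(k, n)`, so a radius `exp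
(-p²)` exceeds every smaller one by a factor of at least `exp (2 p + 1)`. Seen at the scale of a
layer close to the origin, all other layers are therefore negligibly small or very far away
(`IsAdmissible.exists_trichotomy`). The properties of `F` at `0` rest on this separation of scales.

*Tangent sets.* Dilating by `t = α / a_n^k` with `k` fixed and `n → ∞` gives `α (S_k ∪ {0})`;
letting also `k → ∞` gives `α {v, 0}`; dilating so that every layer becomes either small or large,
with nothing in between, gives `{0}`. Conversely, since only one layer is visible at a time, the
points of a nontrivial tangent set other than the base point all have the same distance `α` from it
(`dist_pt_eq_of_mem_tangentCone`), and the tangent set is the limit of sets `α (S_k ∪ {0})`, where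
`k` varies (`exists_corr_of_mem_tangentCone`). Either a single `k` occurs for arbitrarily small
distortion, or `k → ∞` and `S_k` shrinks to `v`. In both cases the tangent set is arbitrarily close
to a finite space, and therefore isometric to it
(`PointedMetricSpace.isIsometricTo_of_forall_corr`). In particular, tangent sets are finite and
their box dimensions vanish.

*Upper tangential dimension and uniformity.* The tangent sets are zero-dimensional, but their
cardinalities are unbounded: the layer `a_n^k S_k` has `k²` points at mutual distances at least `c
a_n^k / k³`. At the ratio `l = c / (2 k³)` at least `k²` balls are needed, and `k² ≥ (1 / l) ^ (1 /
2)` for large `k`. The same layer has diameter at most `a_n^k / k²`, and comparing a ball of this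
order around one of its points with the ball of the same radius around the origin refutes
uniformity. The compactness condition holds because a layer with `1 / k² < l` is covered by a
single ball, and the other layers have at most `1 / l` points each.

*Existence.* Project `k × k` grids of mesh `1 / (8 k³)` in the plane, with corners at `(1 / (2 k),
0)`, vertically to the upper hemisphere; they converge to the north pole.
-/

/-! ### The radii -/

theorem radiusSeq_pos (k n : ℕ) : 0 < radiusSeq k n := Real.exp_pos _

/-- The exponents `(n + k)(n + k + 1) / 2 + k` are integers, and those of distinct pairs are
distinct; hence a strict inequality between two of them leaves a gap of at least one. -/
theorem cantorPair_eq_or_add_one_le (k n k' n' : ℕ) :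
    (k = k' ∧ n = n') ∨
    ((n : ℝ) + k) * ((n : ℝ) + k + 1) / 2 + k + 1 ≤
      ((n' : ℝ) + k') * ((n' : ℝ) + k' + 1) / 2 + k' ∨
    ((n' : ℝ) + k') * ((n' : ℝ) + k' + 1) / 2 + k' + 1 ≤
      ((n : ℝ) + k) * ((n : ℝ) + k + 1) / 2 + k := by
  -- `(s + 1)(s + 2) / 2` exceeds `s (s + 1) / 2` by `s + 1`, which is more than `k`
  have key : ∀ k n k' n' : ℕ, n + k < n' + k' →
      ((n : ℝ) + k) * ((n : ℝ) + k + 1) / 2 + k + 1 ≤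
        ((n' : ℝ) + k') * ((n' : ℝ) + k' + 1) / 2 + k' := by
    intro k n k' n' h
    have h1 : (n : ℝ) + k + 1 ≤ n' + k' := by exact_mod_cast h
    have hn : (0 : ℝ) ≤ n := n.cast_nonneg
    have hk : (0 : ℝ) ≤ k := k.cast_nonneg
    have hk' : (0 : ℝ) ≤ k' := k'.cast_nonneg
    nlinarith
  rcases lt_trichotomy (n + k) (n' + k') with h | h | h
  · exact Or.inr (Or.inl (key k n k' n' h))
  · have hs : (n : ℝ) + k = n' + k' := by exact_mod_cast h
    rcases lt_trichotomy k k' with hk | hk | hk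
    · have : (k : ℝ) + 1 ≤ k' := by exact_mod_cast hk
      rw [hs]
      exact Or.inr (Or.inl (by linarith))
    · exact Or.inl ⟨hk, by omega⟩
    · have : (k' : ℝ) + 1 ≤ k := by exact_mod_cast hk
      rw [hs]
      exact Or.inr (Or.inr (by linarith))
  · exact Or.inr (Or.inr (key k' n' k n h))

/-- Sufficiently far down, distinct radii have ratio at most `η`: the quotient of
`exp (-(p + 1)²)` by `exp (-p²)` is `exp (-(2 p + 1))`. -/
theorem exists_radiusSeq_gap {η : ℝ} (hη : 0 < η) :
    ∃ ρ > 0, ∀ k n k' n' : ℕ, radiusSeq k n < ρ →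
      (k = k' ∧ n = n') ∨ radiusSeq k' n' ≤ η * radiusSeq k n ∨
        radiusSeq k n < radiusSeq k' n' := by
  refine ⟨Real.exp (-(Real.log η) ^ 2), Real.exp_pos _, fun k n k' n' hρ => ?_⟩
  rcases cantorPair_eq_or_add_one_le k n k' n' with h | h | h
  · exact Or.inl h
  · refine Or.inr (Or.inl ?_)
    unfold radiusSeq at hρ ⊢
    set p := ((n : ℝ) + k) * ((n : ℝ) + k + 1) / 2 + k
    set q := ((n' : ℝ) + k') * ((n' : ℝ) + k' + 1) / 2 + k'
    have hp : 0 ≤ p := by positivity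
    have hlog : -Real.log η < p := by
      have h1 := Real.exp_lt_exp.mp hρ
      nlinarith
    rw [← Real.exp_log hη, ← Real.exp_add]
    apply Real.exp_le_exp.mpr
    nlinarith
  · refine Or.inr (Or.inr ?_)
    unfold radiusSeq
    set p := ((n : ℝ) + k) * ((n : ℝ) + k + 1) / 2 + k
    set q := ((n' : ℝ) + k') * ((n' : ℝ) + k' + 1) / 2 + k'
    have hq : 0 ≤ q := by positivity
    apply Real.exp_lt_exp.mpr
    nlinarith

theorem radiusSeq_le_exp_neg (k n : ℕ) : radiusSeq k n ≤ Real.exp (-((n : ℝ) + k)) := by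
  apply Real.exp_le_exp.mpr
  rcases Nat.eq_zero_or_pos (n + k) with h | h
  · obtain ⟨rfl, rfl⟩ : n = 0 ∧ k = 0 := by omega
    simp
  · have h1 : (1 : ℝ) ≤ n + k := by exact_mod_cast h
    have hk : (0 : ℝ) ≤ k := k.cast_nonneg
    have h2 : (n : ℝ) + k ≤ ((n : ℝ) + k) * ((n : ℝ) + k + 1) / 2 + k := by nlinarith
    nlinarith

/-- For fixed `k`, arbitrarily small radii `a_n^k` are available. -/
theorem exists_radiusSeq_lt (k : ℕ) {ρ : ℝ} (hρ : 0 < ρ) :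
    ∃ n, 1 ≤ n ∧ radiusSeq k n < ρ :=
  ((eventually_ge_atTop 1).and ((tendsto_radiusSeq k).eventually_lt_const hρ)).exists

/-! ### Points of `F` -/

namespace IsAdmissible

variable {c : ℝ} {S : ℕ → Finset E3} {v : E3}

theorem norm_eq_one (h : IsAdmissible c S v) {k : ℕ} (hk : 1 ≤ k) {w : E3} (hw : w ∈ S k) :
    ‖w‖ = 1 := by
  simpa using h.subset_sphere k hk hw

theorem norm_smul_eq (h : IsAdmissible c S v) {k : ℕ} (hk : 1 ≤ k) {w : E3} (hw : w ∈ S k)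
    (n : ℕ) : ‖radiusSeq k n • w‖ = radiusSeq k n := by
  rw [norm_smul, h.norm_eq_one hk hw, mul_one, Real.norm_of_nonneg (radiusSeq_pos k n).le]

theorem nonempty (h : IsAdmissible c S v) {k : ℕ} (hk : 1 ≤ k) : (S k).Nonempty := by
  rw [← Finset.card_pos, h.card_eq k hk]
  positivity

theorem smul_mem {k n : ℕ} (hk : 1 ≤ k) (hn : 1 ≤ n) {w : E3} (hw : w ∈ S k) :
    radiusSeq k n • w ∈ setF S :=
  subset_closure ⟨k, n, hk, hn, w, hw, rfl⟩

/-- Taking the closure in the definition of `F` adds only the origin, because only finitely many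
radii exceed any given positive number. -/
theorem eq_zero_or_exists_smul (h : IsAdmissible c S v) {x : E3} (hx : x ∈ setF S) :
    x = 0 ∨ ∃ k n : ℕ, 1 ≤ k ∧ 1 ≤ n ∧ ∃ w ∈ S k, x = radiusSeq k n • w := by
  by_cases hx0 : x = 0
  · exact Or.inl hx0
  right
  have hd : 0 < ‖x‖ := norm_pos_iff.mpr hx0
  set D : Set E3 := {x | ∃ k n : ℕ, 1 ≤ k ∧ 1 ≤ n ∧ ∃ w ∈ S k, x = radiusSeq k n • w} with hD
  set U : Set E3 := {y | ‖x‖ / 2 < ‖y‖} with hU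
  have hUo : IsOpen U := isOpen_lt continuous_const continuous_norm
  have hxU : x ∈ U := by simp only [hU, mem_ofPred_eq]; linarith
  have hfin : (D ∩ U).Finite := by
    obtain ⟨N, hN⟩ := exists_nat_gt (-Real.log (‖x‖ / 2))
    have hfin' : (⋃ k ∈ Set.Iio N, ⋃ n ∈ Set.Iio N,
        (fun w : E3 => radiusSeq k n • w) '' (S k : Set E3)).Finite :=
      (Set.finite_Iio N).biUnion fun k _ => (Set.finite_Iio N).biUnion fun n _ =>
        (S k).finite_toSet.image _
    refine hfin'.subset ?_
    rintro y ⟨⟨k, n, hk, hn, w, hw, rfl⟩, hy⟩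
    have h1 : ‖x‖ / 2 < radiusSeq k n := by
      simpa only [hU, mem_ofPred_eq, h.norm_smul_eq hk hw n] using hy
    have h2 := (Real.log_lt_log (by positivity) (h1.trans_le (radiusSeq_le_exp_neg k n)))
    rw [Real.log_exp] at h2
    have h3 : ((n + k : ℕ) : ℝ) < N := by push_cast; linarith
    have h4 : n + k < N := by exact_mod_cast h3
    simp only [mem_iUnion, mem_Iio, mem_image]
    exact ⟨k, by omega, n, by omega, w, hw, rfl⟩
  have hxcl : x ∈ closure (D ∩ U) := by
    rw [inter_comm]
    exact hUo.inter_closure ⟨hxU, hx⟩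
  rw [hfin.isClosed.closure_eq] at hxcl
  exact hxcl.1

/-- Seen at the scale of a sufficiently small radius `b = a_n^k`, the set `F` consists of `b S_k`,
of points much closer to the origin and of points much farther away. -/
theorem exists_trichotomy (h : IsAdmissible c S v) {η : ℝ} (hη : 0 < η) :
    ∃ ρ > 0, ∀ k n : ℕ, 1 ≤ k → radiusSeq k n < ρ → ∀ x ∈ setF S,
      (∃ w ∈ S k, x = radiusSeq k n • w) ∨ ‖x‖ ≤ η * radiusSeq k n ∨
        radiusSeq k n ≤ η * ‖x‖ := by
  obtain ⟨ρ, hρ, H⟩ := exists_radiusSeq_gap hη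
  -- the factor `η` accounts for the radii that are not themselves below `ρ`
  refine ⟨min ρ (η * ρ), lt_min hρ (by positivity), fun k n hk hb x hx => ?_⟩
  rcases h.eq_zero_or_exists_smul hx with rfl | ⟨k', n', hk', -, w, hw, rfl⟩
  · right; left
    simpa using (mul_pos hη (radiusSeq_pos k n)).le
  · rw [h.norm_smul_eq hk' hw n']
    rcases H k n k' n' (hb.trans_le (min_le_left _ _)) with ⟨rfl, rfl⟩ | h1 | h1
    · exact Or.inl ⟨w, hw, rfl⟩
    · exact Or.inr (Or.inl h1)
    · right; right
      rcases lt_or_ge (radiusSeq k' n') ρ with h2 | h2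
      · rcases H k' n' k n h2 with ⟨rfl, rfl⟩ | h3 | h3
        · exact absurd h1 (lt_irrefl _)
        · exact h3
        · exact absurd h1 h3.not_gt
      · exact (hb.le.trans (min_le_right _ _)).trans (mul_le_mul_of_nonneg_left h2 hη.le)

theorem eventually_dist_limit_lt (h : IsAdmissible c S v) {ε : ℝ} (hε : 0 < ε) :
    ∀ᶠ k in atTop, ∀ w ∈ S k, dist w v < ε := by
  filter_upwards [h.tendsto.eventually_lt_const hε, eventually_ge_atTop 1] with k hk hk1 w hw
  have hne : hausdorffEDist (S k : Set E3) {v} ≠ ⊤ :=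
    hausdorffEDist_ne_top_of_nonempty_of_bounded (h.nonempty hk1) (singleton_nonempty v)
      (S k).finite_toSet.isBounded Bornology.isBounded_singleton
  have := infDist_le_hausdorffDist_of_mem (s := (S k : Set E3)) (t := {v}) (x := w) hw hne
  rw [infDist_singleton] at this
  exact this.trans_lt hk

theorem dist_le (h : IsAdmissible c S v) {k : ℕ} (hk : 1 ≤ k) {u w : E3} (hu : u ∈ S k)
    (hw : w ∈ S k) : dist u w ≤ 1 / (k : ℝ) ^ 2 :=
  (dist_le_diam_of_mem (S k).finite_toSet.isBounded hu hw).trans (h.diam_le k hk)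

end IsAdmissible

/-! ### Covering numbers -/

section Covering

variable {X : Type*} [MetricSpace X]

theorem openCoveringNumber_le_card {r : ℝ} {E : Set X} (s : Finset X)
    (hs : E ⊆ ⋃ y ∈ s, ball y r) : openCoveringNumber r E ≤ s.card :=
  iInf₂_le s hs

/-- An open ball of radius `r` contains at most one point of a `2 r`-separated family. -/
theorem card_le_openCoveringNumber {ι : Type*} {r : ℝ} {E : Set X} (P : Finset ι) (f : ι → X)
    (hf : ∀ i ∈ P, f i ∈ E) (hsep : ∀ i ∈ P, ∀ j ∈ P, i ≠ j → 2 * r ≤ dist (f i) (f j)) :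
    (P.card : ℕ∞) ≤ openCoveringNumber r E := by
  refine le_iInf₂ fun s hs => ?_
  have hex : ∀ i ∈ P, ∃ y ∈ s, f i ∈ ball y r := fun i hi => by
    simpa using hs (hf i hi)
  rcases P.eq_empty_or_nonempty with rfl | ⟨i₀, -⟩
  · simp
  have : Nonempty X := ⟨f i₀⟩
  choose! g hgs hg using hex
  refine Nat.cast_le.mpr (Finset.card_le_card_of_injOn g hgs fun i hi j hj hij => ?_)
  by_contra hne
  have h1 := hsep i hi j hj hne
  have h2 : dist (f i) (g i) < r := hg i hi
  have h3 : dist (f j) (g i) < r := by rw [hij]; exact hg j hj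
  linarith [dist_triangle_right (f i) (f j) (g i)]

theorem logCovering_le {r : ℝ} {E : Set X} {N : ℕ} (hN : openCoveringNumber r E ≤ N) :
    logCovering r E ≤ ((Real.log N : ℝ) : EReal) := by
  have h1 : ((openCoveringNumber r E : ℕ∞) : ℝ≥0∞) ≤ ENNReal.ofReal N := by
    rw [ENNReal.ofReal_natCast]
    exact_mod_cast hN
  rcases Nat.eq_zero_or_pos N with rfl | hpos
  · have h0 : openCoveringNumber r E = 0 := by simpa using hN
    simp [logCovering, h0]
  · exact (ENNReal.log_le_log h1).trans_eq (ENNReal.log_ofReal_of_pos (by exact_mod_cast hpos))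

theorem le_logCovering {r : ℝ} {E : Set X} {N : ℕ} (hpos : 0 < N)
    (hN : (N : ℕ∞) ≤ openCoveringNumber r E) :
    ((Real.log N : ℝ) : EReal) ≤ logCovering r E := by
  have h1 : ENNReal.ofReal N ≤ ((openCoveringNumber r E : ℕ∞) : ℝ≥0∞) := by
    rw [ENNReal.ofReal_natCast]
    exact_mod_cast hN
  exact (ENNReal.log_ofReal_of_pos (by exact_mod_cast hpos)).symm.trans_le
    (ENNReal.log_le_log h1)

theorem tendsto_logCovering_div_of_finite [Finite X] (x : X) {R : ℝ} (hR : 0 < R) :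
    Tendsto (fun r : ℝ => logCovering r (ball x R) / ((Real.log (1 / r) : ℝ) : EReal))
      (𝓝[>] 0) (𝓝 0) := by
  cases nonempty_fintype X
  have hlog : Tendsto (fun r : ℝ => Real.log (1 / r)) (𝓝[>] 0) atTop := by
    simp only [one_div]
    exact Real.tendsto_log_atTop.comp tendsto_inv_nhdsGT_zero
  have hup : Tendsto (fun r : ℝ =>
      ((Real.log (Fintype.card X) / Real.log (1 / r) : ℝ) : EReal)) (𝓝[>] 0) (𝓝 0) :=
    EReal.tendsto_coe.mpr (hlog.const_div_atTop _)
  refine tendsto_of_tendsto_of_tendsto_of_le_of_le' tendsto_const_nhds hup ?_ ?_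
  · filter_upwards [hlog.eventually_ge_atTop 0, self_mem_nhdsWithin] with r hr hr0
    refine EReal.div_nonneg ?_ (by exact_mod_cast hr)
    have := le_logCovering (r := r) (E := ball x R) (N := 1) one_pos
      (card_le_openCoveringNumber {x} id (by simpa using hR) (by simp))
    simpa using this
  · filter_upwards [hlog.eventually_ge_atTop 0, self_mem_nhdsWithin] with r hr hr0
    rw [EReal.coe_div]
    refine EReal.div_le_div_right_of_nonneg (by exact_mod_cast hr) (logCovering_le ?_)
    refine openCoveringNumber_le_card Finset.univ fun y _ => ?_
    simp only [Finset.mem_univ, iUnion_true, mem_iUnion]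
    exact ⟨y, mem_ball_self hr0⟩

theorem lowerBoxDim_of_finite [Finite X] (x : X) : lowerBoxDim x = 0 := by
  have : (fun R : ℝ => liminf (fun r : ℝ =>
      logCovering r (ball x R) / ((Real.log (1 / r) : ℝ) : EReal)) (𝓝[>] 0)) =ᶠ[atTop]
      fun _ => 0 := by
    filter_upwards [eventually_gt_atTop 0] with R hR
    exact (tendsto_logCovering_div_of_finite x hR).liminf_eq
  rw [lowerBoxDim, limsup_congr this, limsup_const]

theorem upperBoxDim_of_finite [Finite X] (x : X) : upperBoxDim x = 0 := by
  have : (fun R : ℝ => limsup (fun r : ℝ =>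
      logCovering r (ball x R) / ((Real.log (1 / r) : ℝ) : EReal)) (𝓝[>] 0)) =ᶠ[atTop]
      fun _ => 0 := by
    filter_upwards [eventually_gt_atTop 0] with R hR
    exact (tendsto_logCovering_div_of_finite x hR).limsup_eq
  rw [upperBoxDim, limsup_congr this, limsup_const]

end Covering

/-! ### Correspondences between pointed metric spaces -/

theorem exists_pos_le_dist {Y : Type*} [MetricSpace Y] [Finite Y] :
    ∃ δ > 0, ∀ y y' : Y, y ≠ y' → δ ≤ dist y y' := by
  have hfin : ((fun p : Y × Y => dist p.1 p.2) '' {p | p.1 ≠ p.2}).Finite := toFinite _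
  have hpos : ∀ᶠ δ in 𝓝[>] (0 : ℝ),
      ∀ d ∈ (fun p : Y × Y => dist p.1 p.2) '' {p | p.1 ≠ p.2}, δ ≤ d := by
    rw [eventually_all_finite hfin]
    rintro _ ⟨p, hp, rfl⟩
    exact nhdsWithin_le_nhds (eventually_le_nhds (dist_pos.mpr hp))
  obtain ⟨δ, h1, h2⟩ := (hpos.and self_mem_nhdsWithin).exists
  exact ⟨δ, h2, fun y y' hy => h1 _ ⟨(y, y'), hy, rfl⟩⟩

namespace PointedMetricSpace

/-- A correspondence between `X` and `Y`, relating the base points to each other and of distortion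
less than `ε`. -/
def Corr (ε : ℝ) (X Y : PointedMetricSpace) : Prop :=
  ∃ r : X.carrier → Y.carrier → Prop, r X.pt Y.pt ∧ (∀ x, ∃ y, r x y) ∧ (∀ y, ∃ x, r x y) ∧
    ∀ x y x' y', r x y → r x' y' → |dist x x' - dist y y'| < ε

theorem Corr.trans {ε ε' : ℝ} {X Y Z : PointedMetricSpace} (h : Corr ε X Y) (h' : Corr ε' Y Z) :
    Corr (ε + ε') X Z := by
  obtain ⟨r, r1, r2, r3, r4⟩ := h
  obtain ⟨s, s1, s2, s3, s4⟩ := h'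
  refine ⟨fun x z => ∃ y, r x y ∧ s y z, ⟨_, r1, s1⟩, fun x => ?_, fun z => ?_, ?_⟩
  · obtain ⟨y, hy⟩ := r2 x
    obtain ⟨z, hz⟩ := s2 y
    exact ⟨z, y, hy, hz⟩
  · obtain ⟨y, hy⟩ := s3 z
    obtain ⟨x, hx⟩ := r3 y
    exact ⟨x, y, hx, hy⟩
  · rintro x z x' z' ⟨y, hxy, hyz⟩ ⟨y', hxy', hyz'⟩
    have h1 := r4 _ _ _ _ hxy hxy'
    have h2 := s4 _ _ _ _ hyz hyz'
    rw [abs_lt] at h1 h2 ⊢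
    constructor <;> linarith [h1.1, h1.2, h2.1, h2.2]

theorem Corr.mono {ε ε' : ℝ} {X Y : PointedMetricSpace} (h : Corr ε X Y) (hε : ε ≤ ε') :
    Corr ε' X Y := by
  obtain ⟨r, r1, r2, r3, r4⟩ := h
  exact ⟨r, r1, r2, r3, fun x y x' y' h1 h2 => (r4 x y x' y' h1 h2).trans_le hε⟩

/-- A pointed metric space which is arbitrarily close to a finite one is isometric to it. First
its number of points is bounded, so that it is finite; then a correspondence whose distortion is
below every nonzero difference of distances is the graph of an isometry. -/
theorem isIsometricTo_of_forall_corr {X Y : PointedMetricSpace} [Finite Y.carrier]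
    (h : ∀ ε > 0, Corr ε X Y) : X.IsIsometricTo Y := by
  obtain ⟨δ, hδ, hsep⟩ := exists_pos_le_dist (Y := Y.carrier)
  have hfinX : Finite X.carrier := by
    by_contra hinf
    rw [not_finite_iff_infinite] at hinf
    obtain ⟨s, hs⟩ := Infinite.exists_subset_card_eq X.carrier (Nat.card Y.carrier + 1)
    obtain ⟨δ', hδ', hsep'⟩ := exists_pos_le_dist (Y := s)
    obtain ⟨r, -, r2, -, r4⟩ := h δ' hδ'
    choose f hf using r2
    have hinj : Function.Injective fun x : s => f x := by
      intro x x' hxx'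
      by_contra hne
      have h1 := r4 _ _ _ _ (hf x) (hf x')
      have h2 : dist (f x) (f x') = 0 := by rw [dist_eq_zero]; exact hxx'
      rw [h2, sub_zero, abs_of_nonneg dist_nonneg] at h1
      exact absurd (hsep' x x' hne) h1.not_ge
    have := Nat.card_le_card_of_injective _ hinj
    rw [Nat.card_eq_fintype_card, Fintype.card_coe, hs] at this
    omega
  obtain ⟨δ', hδ', hsep'⟩ := exists_pos_le_dist (Y := X.carrier)
  have hfin : ((fun p : (X.carrier × X.carrier) × (Y.carrier × Y.carrier) =>
      |dist p.1.1 p.1.2 - dist p.2.1 p.2.2|) ''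
      {p | |dist p.1.1 p.1.2 - dist p.2.1 p.2.2| ≠ 0}).Finite := toFinite _
  have hev : ∀ᶠ ε in 𝓝[>] (0 : ℝ), ∀ d ∈ (fun p : (X.carrier × X.carrier) ×
      (Y.carrier × Y.carrier) => |dist p.1.1 p.1.2 - dist p.2.1 p.2.2|) ''
      {p | |dist p.1.1 p.1.2 - dist p.2.1 p.2.2| ≠ 0}, ε ≤ d := by
    rw [eventually_all_finite hfin]
    rintro _ ⟨p, hp, rfl⟩
    exact nhdsWithin_le_nhds (eventually_le_nhds (lt_of_le_of_ne (abs_nonneg _) (Ne.symm hp)))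
  obtain ⟨ε, h1, hε : 0 < ε⟩ := (hev.and self_mem_nhdsWithin).exists
  obtain ⟨r, r1, r2, r3, r4⟩ := h ε hε
  have hdist : ∀ x y x' y', r x y → r x' y' → dist x x' = dist y y' := by
    intro x y x' y' hxy hxy'
    by_contra hne
    have := h1 _ ⟨((x, x'), (y, y')), abs_ne_zero.mpr (sub_ne_zero.mpr hne), rfl⟩
    exact absurd (r4 _ _ _ _ hxy hxy') this.not_gt
  choose f hf using r2
  have hiso : Isometry f := Isometry.of_dist_eq fun x x' => (hdist _ _ _ _ (hf x) (hf x')).symm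
  have huniq : ∀ x y, r x y → f x = y := fun x y hxy => by
    rw [← dist_eq_zero, ← hdist _ _ _ _ (hf x) hxy, dist_self]
  have hsurj : Function.Surjective f := fun y => by
    obtain ⟨x, hx⟩ := r3 y
    exact ⟨x, huniq x y hx⟩
  exact ⟨⟨Equiv.ofBijective f ⟨hiso.injective, hsurj⟩, hiso⟩, huniq _ _ r1⟩

end PointedMetricSpace

open PointedMetricSpace

/-! ### Tangent sets of `F` and the models -/

theorem IsTangentModel.finite_set {S : ℕ → Finset E3} {v : E3} {A : Set E3}
    (hA : IsTangentModel S v A) : A.Finite := by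
  cases hA with
  | zero => exact finite_singleton _
  | finite k hk => exact (S k).finite_toSet.insert _
  | infinite => exact (finite_singleton _).insert _

theorem finite_dilate_ofSet {A : Set E3} (hA : A.Finite) (h0 : (0 : E3) ∈ A) {α : ℝ}
    (hα : 0 < α) : Finite ((ofSet A 0 h0).dilate α hα).carrier :=
  hA.to_subtype

section

variable {c : ℝ} {S : ℕ → Finset E3} {v : E3}

/-- Nearness of a dilated finite set `α A` and `t F` inside `E3` gives nearness of pointed
spaces. -/
theorem pghClose_of_near (h : IsAdmissible c S v) {T : PointedMetricSpace} {A : Set E3}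
    (hA : (0 : E3) ∈ A) {α : ℝ} (hα : 0 < α)
    (hT : T.IsIsometricTo ((ofSet A 0 hA).dilate α hα)) {R ε t : ℝ} (hε : 0 < ε) (ht : 0 < t)
    (h1 : ∀ w ∈ A, ∃ y ∈ setF S, dist (α • w) (t • y) < ε)
    (h2 : ∀ y ∈ setF S, t * ‖y‖ ≤ R → ∃ w ∈ A, dist (t • y) (α • w) < ε) :
    PGHClose R ε T ((pointedF h).dilate t ht) := by
  obtain ⟨e, he⟩ := hT
  let φ : ((ofSet A 0 hA).dilate α hα).carrier → E3 := fun w => α • (show A from w).1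
  let ψ : ((pointedF h).dilate t ht).carrier → E3 := fun y => t • (show setF S from y).1
  have hφ : Isometry φ := Isometry.of_dist_eq fun w w' => by
    change dist (α • (show A from w).1) (α • (show A from w').1) =
      α * dist (show A from w).1 (show A from w').1
    rw [dist_smul₀, Real.norm_of_nonneg hα.le]
  have hψ : Isometry ψ := Isometry.of_dist_eq fun w w' => by
    change dist (t • (show setF S from w).1) (t • (show setF S from w').1) =
      t * dist (show setF S from w).1 (show setF S from w').1
    rw [dist_smul₀, Real.norm_of_nonneg ht.le]
  refine ⟨E3, inferInstance, φ ∘ e, ψ, hφ.comp e.isometry, hψ, ?_, ?_, ?_⟩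
  · have e1 : (φ ∘ e) T.pt = 0 := by
      rw [Function.comp, he]
      exact smul_zero α
    have e2 : ψ ((pointedF h).dilate t ht).pt = 0 := smul_zero t
    rw [e1, e2, dist_self]
    exact hε
  · rintro _ ⟨x, -, rfl⟩
    obtain ⟨y, hy, hd⟩ := h1 (show A from e x).1 (show A from e x).2
    exact mem_thickening_iff.mpr ⟨t • y, ⟨⟨y, hy⟩, rfl⟩, hd⟩
  · rintro _ ⟨y, hyR, rfl⟩
    have hyR' : t * dist (show setF S from y).1 0 ≤ R := hyR
    rw [dist_zero_right] at hyR'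
    obtain ⟨w, hw, hd⟩ := h2 (show setF S from y).1 (show setF S from y).2 hyR'
    refine mem_thickening_iff.mpr ⟨α • w, ⟨e.symm ⟨w, hw⟩, ?_⟩, hd⟩
    exact congrArg φ (e.apply_symm_apply _)

/-- Nearness of `T` and `t F` yields a relation between their points of small distortion, defined
on large balls. -/
theorem exists_rel_of_pghClose (h : IsAdmissible c S v) {T : PointedMetricSpace} {R ε t : ℝ}
    (ht : 0 < t) (hc : PGHClose R ε T ((pointedF h).dilate t ht)) :
    ∃ r : T.carrier → E3 → Prop, (∀ x y, r x y → y ∈ setF S) ∧ r T.pt 0 ∧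
      (∀ x, dist x T.pt ≤ R → ∃ y, r x y) ∧ (∀ y ∈ setF S, t * ‖y‖ ≤ R → ∃ x, r x y) ∧
      ∀ x y x' y', r x y → r x' y' → |dist x x' - t * dist y y'| < 2 * ε := by
  obtain ⟨Z, _, φ, ψ, hφ, hψ, hpt, hX, hY⟩ := hc
  refine ⟨fun x y => ∃ hy : y ∈ setF S, dist (φ x) (ψ ⟨y, hy⟩) < ε, ?_, ?_, ?_, ?_, ?_⟩
  · rintro x y ⟨hy, -⟩
    exact hy
  · exact ⟨h.zero_mem, hpt⟩
  · intro x hx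
    obtain ⟨_, ⟨y, rfl⟩, hd⟩ := mem_thickening_iff.mp (hX ⟨x, hx, rfl⟩)
    exact ⟨(show setF S from y).1, (show setF S from y).2, hd⟩
  · intro y hy hyR
    have hmem : (show ((pointedF h).dilate t ht).carrier from (⟨y, hy⟩ : setF S)) ∈
        closedBall ((pointedF h).dilate t ht).pt R := by
      change t * dist y 0 ≤ R
      rwa [dist_zero_right]
    obtain ⟨_, ⟨x, rfl⟩, hd⟩ := mem_thickening_iff.mp (hY ⟨_, hmem, rfl⟩)
    exact ⟨x, hy, by rw [dist_comm]; exact hd⟩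
  · rintro x y x' y' ⟨hy, hd⟩ ⟨hy', hd'⟩
    have h1 : dist (ψ ⟨y, hy⟩) (ψ ⟨y', hy'⟩) = t * dist y y' := hψ.dist_eq _ _
    have h2 := abs_dist_sub_le (φ x) (ψ ⟨y, hy⟩) (φ x')
    have h3 := abs_dist_sub_le (φ x') (ψ ⟨y', hy'⟩) (ψ ⟨y, hy⟩)
    rw [hφ.dist_eq] at h2
    rw [dist_comm (ψ ⟨y', hy'⟩), h1, dist_comm (φ x')] at h3
    rw [abs_le] at h2 h3
    rw [abs_lt]
    constructor <;> linarith [h2.1, h2.2, h3.1, h3.2]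

/-- At a factor `t` with `t a_n^k = α`, the points of `t F` of norm at most `R` are those of
`α S_k` and points close to the origin. -/
theorem exists_near_smul (h : IsAdmissible c S v) {k : ℕ} (hk : 1 ≤ k) {α R ε t₀ : ℝ}
    (hα : 0 < α) (hR : 0 < R) (hε : 0 < ε) :
    ∃ t ≥ t₀, 0 < t ∧ (∀ w ∈ S k, ∃ y ∈ setF S, t • y = α • w) ∧
      ∀ y ∈ setF S, t * ‖y‖ ≤ R → (∃ w ∈ S k, t • y = α • w) ∨ ‖t • y‖ < ε := by
  obtain ⟨η, hη, hη1, hη2⟩ : ∃ η > 0, η * α < ε ∧ η * R < α := by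
    refine ⟨min (ε / (2 * α)) (α / (2 * R)), by positivity, ?_, ?_⟩
    · refine (mul_le_mul_of_nonneg_right (min_le_left _ _) hα.le).trans_lt ?_
      rw [div_mul_eq_mul_div, div_lt_iff₀ (by positivity)]
      nlinarith [mul_pos hε hα]
    · refine (mul_le_mul_of_nonneg_right (min_le_right _ _) hR.le).trans_lt ?_
      rw [div_mul_eq_mul_div, div_lt_iff₀ (by positivity)]
      nlinarith [mul_pos hR hα]
  obtain ⟨ρ, hρ, H⟩ := h.exists_trichotomy hη
  obtain ⟨n, hn, hb⟩ := exists_radiusSeq_lt k (ρ := min ρ (α / max t₀ 1)) (by positivity)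
  have hb0 := radiusSeq_pos k n
  set b := radiusSeq k n with hbdef
  have htb : α / b * b = α := div_mul_cancel₀ _ hb0.ne'
  refine ⟨α / b, ?_, by positivity, fun w hw => ?_, fun y hy hyR => ?_⟩
  · have h1 : b * max t₀ 1 < α := (lt_div_iff₀ (by positivity)).mp (hb.trans_le (min_le_right _ _))
    refine (le_max_left t₀ 1).trans ?_
    rw [le_div_iff₀ hb0]
    linarith
  · refine ⟨b • w, IsAdmissible.smul_mem hk hn hw, ?_⟩
    rw [smul_smul, htb]
  · have ht0 : 0 < α / b := by positivity
    rcases H k n hk (hb.trans_le (min_le_left _ _)) y hy with ⟨w, hw, rfl⟩ | h1 | h1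
    · refine Or.inl ⟨w, hw, ?_⟩
      rw [smul_smul, htb]
    · right
      rw [norm_smul, Real.norm_of_nonneg ht0.le]
      calc α / b * ‖y‖ ≤ α / b * (η * b) := mul_le_mul_of_nonneg_left h1 ht0.le
        _ = η * α := by rw [mul_left_comm, htb]
        _ < ε := hη1
    · exfalso
      have h2 := mul_le_mul_of_nonneg_left h1 ht0.le
      rw [htb] at h2
      have h3 := mul_le_mul_of_nonneg_left hyR hη.le
      linarith [mul_left_comm (α / b) η ‖y‖]

/-- Dilated models are tangent sets. -/
theorem mem_tangentCone_of_isTangentModel (h : IsAdmissible c S v) {T : PointedMetricSpace}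
    {A : Set E3} (hA : (0 : E3) ∈ A) {α : ℝ} (hα : 0 < α) (hmod : IsTangentModel S v A)
    (hT : T.IsIsometricTo ((ofSet A 0 hA).dilate α hα)) : T ∈ tangentCone (pointedF h) := by
  constructor
  · have := finite_dilate_ofSet hmod.finite_set hA hα
    obtain ⟨e, -⟩ := hT
    have : Finite T.carrier := Finite.of_equiv _ e.symm.toEquiv
    infer_instance
  intro R ε hR hε
  rw [frequently_atTop]
  intro t₀
  cases hmod with
  | zero =>
    -- dilate until a layer of `F` lies just outside the ball of radius `R`
    obtain ⟨t, htt, ht, -, h2⟩ :=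
      exists_near_smul h le_rfl (k := 1) (α := 2 * R) (t₀ := t₀) (by positivity) hR hε
    refine ⟨t, htt, ht, pghClose_of_near h hA hα hT hε ht ?_ ?_⟩
    · rintro w rfl
      exact ⟨0, h.zero_mem, by simpa using hε⟩
    · intro y hy hyR
      refine ⟨0, rfl, ?_⟩
      rw [smul_zero, dist_zero_right]
      rcases h2 y hy hyR with ⟨w, hw, h3⟩ | h3
      · have h4 := congrArg norm h3
        rw [norm_smul, norm_smul, h.norm_eq_one le_rfl hw, Real.norm_of_nonneg ht.le,
          Real.norm_of_nonneg (by positivity)] at h4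
        linarith
      · exact h3
  | finite k hk =>
    obtain ⟨t, htt, ht, h1, h2⟩ := exists_near_smul h hk (t₀ := t₀) hα hR hε
    refine ⟨t, htt, ht, pghClose_of_near h hA hα hT hε ht ?_ ?_⟩
    · rintro w (rfl | hw)
      · exact ⟨0, h.zero_mem, by simpa using hε⟩
      · obtain ⟨y, hy, h3⟩ := h1 w hw
        exact ⟨y, hy, by rw [h3, dist_self]; exact hε⟩
    · intro y hy hyR
      rcases h2 y hy hyR with ⟨w, hw, h3⟩ | h3
      · exact ⟨w, Or.inr hw, by rw [h3, dist_self]; exact hε⟩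
      · exact ⟨0, hA, by rwa [smul_zero, dist_zero_right]⟩
  | infinite =>
    obtain ⟨k, hkv, hk⟩ := ((h.eventually_dist_limit_lt (ε := ε / α) (by positivity)).and
      (eventually_ge_atTop 1)).exists
    have hd : ∀ w ∈ S k, dist (α • w) (α • v) < ε := fun w hw => by
      rw [dist_smul₀, Real.norm_of_nonneg hα.le, mul_comm, ← lt_div_iff₀ hα]
      exact hkv w hw
    obtain ⟨t, htt, ht, h1, h2⟩ := exists_near_smul h hk (t₀ := t₀) hα hR hε
    refine ⟨t, htt, ht, pghClose_of_near h hA hα hT hε ht ?_ ?_⟩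
    · rintro w (rfl | rfl)
      · exact ⟨0, h.zero_mem, by simpa using hε⟩
      · obtain ⟨u, hu⟩ := h.nonempty hk
        obtain ⟨y, hy, h3⟩ := h1 u hu
        exact ⟨y, hy, by rw [h3, dist_comm]; exact hd u hu⟩
    · intro y hy hyR
      rcases h2 y hy hyR with ⟨w, hw, h3⟩ | h3
      · exact ⟨v, Or.inr rfl, by rw [h3]; exact hd w hw⟩
      · exact ⟨0, hA, by rwa [smul_zero, dist_zero_right]⟩

/-- All points of a tangent set other than the base point have the same distance from it, because
at each small scale `F` has only one layer. -/
theorem dist_pt_eq_of_mem_tangentCone (h : IsAdmissible c S v) {T : PointedMetricSpace}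
    (hT : T ∈ tangentCone (pointedF h)) {p q : T.carrier} (hp : p ≠ T.pt) (hq : q ≠ T.pt) :
    dist p T.pt = dist q T.pt := by
  by_contra hne
  have hα : 0 < dist p T.pt := dist_pos.mpr hp
  have hβ : 0 < dist q T.pt := dist_pos.mpr hq
  set α := dist p T.pt
  set β := dist q T.pt
  have hαβ : 0 < |α - β| := abs_pos.mpr (sub_ne_zero.mpr hne)
  obtain ⟨ε, hε, hε1, hε2, hε3⟩ : ∃ ε > 0, 4 * ε ≤ α ∧ 4 * ε ≤ β ∧ 4 * ε ≤ |α - β| := by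
    refine ⟨min (min α β) |α - β| / 4, by positivity, ?_, ?_, ?_⟩
    · linarith [min_le_left (min α β) |α - β|, min_le_left α β]
    · linarith [min_le_left (min α β) |α - β|, min_le_right α β]
    · linarith [min_le_right (min α β) |α - β|]
  -- a layer seen at distance about `α` and a point seen at distance about `β` have a ratio of norms
  -- strictly between `η` and `1 / η`, so that the point lies in the same layer
  obtain ⟨η, hη, hη1, hη2⟩ : ∃ η > 0, η * (2 * α) < β / 2 ∧ η * (2 * β) < α / 2 := by
    refine ⟨min (β / (5 * α)) (α / (5 * β)), by positivity, ?_, ?_⟩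
    · refine (mul_le_mul_of_nonneg_right (min_le_left _ _) (by positivity)).trans_lt ?_
      rw [div_mul_eq_mul_div, div_lt_iff₀ (by positivity)]
      nlinarith [mul_pos hα hβ]
    · refine (mul_le_mul_of_nonneg_right (min_le_right _ _) (by positivity)).trans_lt ?_
      rw [div_mul_eq_mul_div, div_lt_iff₀ (by positivity)]
      nlinarith [mul_pos hα hβ]
  obtain ⟨ρ, hρ, H⟩ := h.exists_trichotomy hη
  obtain ⟨t, htt, ht, hc⟩ :=
    (frequently_atTop.mp (hT.2 (max α β) ε (by positivity) hε)) (2 * α / ρ)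
  obtain ⟨r, r0, r1, r2, -, r4⟩ := exists_rel_of_pghClose h ht hc
  obtain ⟨y, hy⟩ := r2 p (le_max_left _ _)
  obtain ⟨z, hz⟩ := r2 q (le_max_right _ _)
  have h1 := abs_lt.mp (r4 _ _ _ _ hy r1)
  have h2 := abs_lt.mp (r4 _ _ _ _ hz r1)
  rw [dist_zero_right] at h1 h2
  change -(2 * ε) < α - _ ∧ α - _ < _ at h1
  change -(2 * ε) < β - _ ∧ β - _ < _ at h2
  rcases h.eq_zero_or_exists_smul (r0 _ _ hy) with rfl | ⟨k, n, hk, -, w, hw, rfl⟩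
  · rw [norm_zero, mul_zero] at h1
    linarith
  rw [h.norm_smul_eq hk hw] at h1
  set b := radiusSeq k n
  have hb : b < ρ := by
    have h3 := (div_le_iff₀ hρ).mp htt
    have h4 : t * b < t * ρ := by linarith
    exact lt_of_mul_lt_mul_left h4 ht.le
  rcases H k n hk hb z (r0 _ _ hz) with ⟨w', hw', rfl⟩ | h3 | h3
  · rw [h.norm_smul_eq hk hw'] at h2
    have : |α - β| < 4 * ε := by
      rw [abs_lt]
      constructor <;> linarith [h1.1, h1.2, h2.1, h2.2]
    linarith
  · have h4 := mul_le_mul_of_nonneg_left h3 ht.le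
    have h5 : η * (t * b) ≤ η * (2 * α) := mul_le_mul_of_nonneg_left (by linarith) hη.le
    linarith [mul_left_comm t η b]
  · have h4 := mul_le_mul_of_nonneg_left h3 ht.le
    have h5 : η * (t * ‖z‖) ≤ η * (2 * β) := mul_le_mul_of_nonneg_left (by linarith) hη.le
    linarith [mul_left_comm t η ‖z‖]

/-- A tangent set whose points other than the base point have distance `α` from it is
arbitrarily close to sets `α (S_k ∪ {0})`. -/
theorem exists_corr_of_mem_tangentCone (h : IsAdmissible c S v) {T : PointedMetricSpace}
    (hT : T ∈ tangentCone (pointedF h)) {p : T.carrier} {α : ℝ} (hα : 0 < α)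
    (hp : dist p T.pt = α) (hall : ∀ x, dist x T.pt ≤ α) {ε : ℝ} (hε : 0 < ε) :
    ∃ k, 1 ≤ k ∧ Corr ε T
      ((ofSet (insert 0 (S k : Set E3)) 0 (mem_insert _ _)).dilate α hα) := by
  obtain ⟨δ, hδ, hδ1, hδ2⟩ : ∃ δ > 0, 4 * δ ≤ α ∧ 8 * δ ≤ ε := by
    refine ⟨min (α / 4) (ε / 8), by positivity, ?_, ?_⟩
    · linarith [min_le_left (α / 4) (ε / 8)]
    · linarith [min_le_right (α / 4) (ε / 8)]
  -- smaller layers are seen within `δ` of the origin, larger ones outside the ball of radius `2 α`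
  obtain ⟨η, hη, hη1, hη2⟩ : ∃ η > 0, η * (2 * α) < δ ∧ η * (2 * α) < α / 2 := by
    refine ⟨δ / (4 * α), by positivity, ?_, ?_⟩
    · rw [div_mul_eq_mul_div, div_lt_iff₀ (by positivity)]
      nlinarith [mul_pos hα hδ]
    · rw [div_mul_eq_mul_div, div_lt_iff₀ (by positivity)]
      nlinarith [mul_pos hα hδ]
  obtain ⟨ρ, hρ, H⟩ := h.exists_trichotomy hη
  obtain ⟨t, htt, ht, hc⟩ :=
    (frequently_atTop.mp (hT.2 (2 * α) δ (by positivity) hδ)) (2 * α / ρ)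
  obtain ⟨r, r0, r1, r2, r3, r4⟩ := exists_rel_of_pghClose h ht hc
  obtain ⟨y, hy⟩ := r2 p (by linarith)
  have h1 := abs_lt.mp (r4 _ _ _ _ hy r1)
  rw [dist_zero_right, hp] at h1
  rcases h.eq_zero_or_exists_smul (r0 _ _ hy) with rfl | ⟨k, n, hk, hn, w₀, hw₀, rfl⟩
  · rw [norm_zero, mul_zero] at h1
    linarith
  rw [h.norm_smul_eq hk hw₀] at h1
  set b := radiusSeq k n
  have hb : b < ρ := by
    have h3 := (div_le_iff₀ hρ).mp htt
    have h4 : t * b < t * ρ := by linarith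
    exact lt_of_mul_lt_mul_left h4 ht.le
  have hlayer : ∀ w ∈ S k, dist (t • b • w) (α • w) < 2 * δ := fun w hw => by
    rw [smul_smul, dist_eq_norm, ← sub_smul, norm_smul, h.norm_eq_one hk hw, mul_one,
      Real.norm_eq_abs, abs_lt]
    constructor <;> linarith
  refine ⟨k, hk, fun x w => ∃ y, r x y ∧
    dist (t • y) (α • (show (insert 0 (S k : Set E3) : Set E3) from w).1) < 2 * δ,
    ⟨0, r1, ?_⟩, fun x => ?_, ?_, ?_⟩
  · change dist (t • (0 : E3)) (α • (0 : E3)) < 2 * δ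
    rw [smul_zero, smul_zero, dist_self]
    positivity
  · obtain ⟨y, hxy⟩ := r2 x (by linarith [hall x])
    rcases H k n hk hb y (r0 _ _ hxy) with ⟨w, hw, rfl⟩ | h3 | h3
    · exact ⟨⟨w, Or.inr hw⟩, _, hxy, hlayer w hw⟩
    · refine ⟨⟨0, mem_insert _ _⟩, y, hxy, ?_⟩
      change dist (t • y) (α • (0 : E3)) < 2 * δ
      rw [smul_zero, dist_zero_right, norm_smul, Real.norm_of_nonneg ht.le]
      have h4 := mul_le_mul_of_nonneg_left h3 ht.le
      have h5 : η * (t * b) ≤ η * (2 * α) := mul_le_mul_of_nonneg_left (by linarith) hη.le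
      linarith [mul_left_comm t η b]
    · exfalso
      have h2 := abs_lt.mp (r4 _ _ _ _ hxy r1)
      rw [dist_zero_right] at h2
      have h4 := mul_le_mul_of_nonneg_left h3 ht.le
      have h5 : η * (t * ‖y‖) ≤ η * (2 * α) :=
        mul_le_mul_of_nonneg_left (by linarith [hall x]) hη.le
      linarith [mul_left_comm t η ‖y‖]
  · rintro ⟨w, rfl | hw⟩
    · refine ⟨T.pt, 0, r1, ?_⟩
      change dist (t • (0 : E3)) (α • (0 : E3)) < 2 * δ
      rw [smul_zero, smul_zero, dist_self]
      positivity
    · obtain ⟨x, hx⟩ := r3 (b • w) (IsAdmissible.smul_mem hk hn hw)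
        (by rw [h.norm_smul_eq hk hw]; linarith)
      exact ⟨x, _, hx, hlayer w hw⟩
  · rintro x ⟨w, hw⟩ x' ⟨w', hw'⟩ ⟨y, hxy, hd⟩ ⟨y', hxy', hd'⟩
    change |dist x x' - α * dist w w'| < ε
    change dist (t • y) (α • w) < _ at hd
    change dist (t • y') (α • w') < _ at hd'
    have h2 := abs_lt.mp (r4 _ _ _ _ hxy hxy')
    have h3 := abs_le.mp (abs_dist_sub_le (t • y) (α • w) (t • y'))
    have h4 := abs_le.mp (abs_dist_sub_le (t • y') (α • w') (α • w))
    rw [dist_comm (t • y') (α • w), dist_comm (α • w') (α • w), dist_smul₀ α,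
      Real.norm_of_nonneg hα.le] at h4
    rw [dist_smul₀ t, Real.norm_of_nonneg ht.le] at h3
    rw [abs_lt]
    constructor <;> linarith [h2.1, h2.2, h3.1, h3.2, h4.1, h4.2]

/-- For large `k` the set `α (S_k ∪ {0})` is close to `α {v, 0}`. -/
theorem eventually_corr_infinite (h : IsAdmissible c S v) {α ε : ℝ} (hα : 0 < α) (hε : 0 < ε) :
    ∀ᶠ k in atTop, Corr ε
      ((ofSet (insert 0 (S k : Set E3)) 0 (mem_insert _ _)).dilate α hα)
      ((ofSet (insert 0 ({v} : Set E3)) 0 (mem_insert _ _)).dilate α hα) := by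
  filter_upwards [h.eventually_dist_limit_lt (ε := ε / (2 * α)) (by positivity),
    eventually_ge_atTop 1] with k hk hk1
  have hδ : 0 < ε / (2 * α) := by positivity
  refine ⟨fun w u => dist (show (insert 0 (S k : Set E3) : Set E3) from w).1
    (show (insert 0 ({v} : Set E3) : Set E3) from u).1 < ε / (2 * α), ?_, ?_, ?_, ?_⟩
  · change dist (0 : E3) 0 < _
    rwa [dist_self]
  · rintro ⟨w, rfl | hw⟩
    · refine ⟨⟨0, mem_insert _ _⟩, ?_⟩
      change dist (0 : E3) 0 < _
      rwa [dist_self]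
    · exact ⟨⟨v, Or.inr rfl⟩, hk w hw⟩
  · rintro ⟨u, rfl | rfl⟩
    · refine ⟨⟨0, mem_insert _ _⟩, ?_⟩
      change dist (0 : E3) 0 < _
      rwa [dist_self]
    · obtain ⟨w, hw⟩ := h.nonempty hk1
      exact ⟨⟨w, Or.inr hw⟩, hk w hw⟩
  · rintro ⟨w, hw⟩ ⟨u, hu⟩ ⟨w', hw'⟩ ⟨u', hu'⟩ hd hd'
    change dist w u < _ at hd
    change dist w' u' < _ at hd'
    change |α * dist w w' - α * dist u u'| < ε
    rw [lt_div_iff₀ (by positivity)] at hd hd'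
    have h3 := abs_le.mp (abs_dist_sub_le w u w')
    have h4 := abs_le.mp (abs_dist_sub_le w' u' u)
    rw [dist_comm w' u, dist_comm u' u] at h4
    rw [← mul_sub, abs_mul, abs_of_pos hα]
    have h5 : |dist w w' - dist u u'| ≤ dist w u + dist w' u' := by
      rw [abs_le]
      constructor <;> linarith [h3.1, h3.2, h4.1, h4.2]
    nlinarith [mul_le_mul_of_nonneg_left h5 hα.le]

/-- Every tangent set is a dilated model. -/
theorem exists_isTangentModel_of_mem_tangentCone (h : IsAdmissible c S v)
    {T : PointedMetricSpace} (hT : T ∈ tangentCone (pointedF h)) :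
    ∃ (A : Set E3) (hA : (0 : E3) ∈ A) (α : ℝ) (hα : 0 < α), IsTangentModel S v A ∧
      T.IsIsometricTo ((ofSet A 0 hA).dilate α hα) := by
  by_cases htriv : ∀ x : T.carrier, x = T.pt
  · refine ⟨{0}, rfl, 1, one_pos, .zero, ?_⟩
    have := finite_dilate_ofSet (finite_singleton (0 : E3)) rfl one_pos
    refine isIsometricTo_of_forall_corr fun ε hε => ⟨fun _ _ => True, trivial,
      fun x => ⟨⟨0, rfl⟩, trivial⟩, fun y => ⟨T.pt, trivial⟩, ?_⟩
    rintro x ⟨y, rfl⟩ x' ⟨y', rfl⟩ - -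
    change |dist x x' - 1 * dist (0 : E3) 0| < ε
    rw [htriv x, htriv x', dist_self, dist_self, mul_zero, sub_zero, abs_zero]
    exact hε
  · push Not at htriv
    obtain ⟨p, hp⟩ := htriv
    have hα : 0 < dist p T.pt := dist_pos.mpr hp
    have hall : ∀ x, dist x T.pt ≤ dist p T.pt := fun x => by
      by_cases hx : x = T.pt
      · rw [hx, dist_self]
        exact hα.le
      · exact (dist_pt_eq_of_mem_tangentCone h hT hx hp).le
    have hcorr := fun ε hε => exists_corr_of_mem_tangentCone h hT hα rfl hall (ε := ε) hε
    by_cases hk : ∃ k, 1 ≤ k ∧ ∀ ε > 0, Corr ε T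
        ((ofSet (insert 0 (S k : Set E3)) 0 (mem_insert _ _)).dilate _ hα)
    · obtain ⟨k, hk1, hk⟩ := hk
      have := finite_dilate_ofSet (IsTangentModel.finite (S := S) (v := v) k hk1).finite_set
        (mem_insert _ _) hα
      exact ⟨_, mem_insert _ _, _, hα, .finite k hk1, isIsometricTo_of_forall_corr hk⟩
    · -- no single `k` serves for all `ε`, so that the indices `k` tend to infinity
      push Not at hk
      have := finite_dilate_ofSet (IsTangentModel.infinite (S := S) (v := v)).finite_set
        (mem_insert _ _) hα
      refine ⟨_, mem_insert _ _, _, hα, .infinite, isIsometricTo_of_forall_corr fun ε hε => ?_⟩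
      obtain ⟨K, hK⟩ := eventually_atTop.mp (eventually_corr_infinite h hα (half_pos hε))
      have hsmall : ∀ᶠ ε' in 𝓝[>] (0 : ℝ), ∀ k ∈ Finset.Ico 1 K, ¬ Corr ε' T
          ((ofSet (insert 0 (S k : Set E3)) 0 (mem_insert _ _)).dilate _ hα) := by
        rw [Filter.eventually_all_finset]
        intro k hkK
        obtain ⟨ε₁, hε₁, hne⟩ := hk k (Finset.mem_Ico.mp hkK).1
        exact nhdsWithin_le_nhds ((eventually_le_nhds hε₁).mono fun ε' hε' hc =>
          hne (hc.mono hε'))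
      obtain ⟨ε', ⟨h1, h2⟩, hε'⟩ := ((hsmall.and (nhdsWithin_le_nhds
        (eventually_le_nhds (half_pos hε)))).and self_mem_nhdsWithin).exists
      obtain ⟨k, hk1, hck⟩ := hcorr ε' hε'
      have hkK : K ≤ k := by
        by_contra hlt
        exact h1 k (Finset.mem_Ico.mpr ⟨hk1, not_le.mp hlt⟩) hck
      exact ((hck.mono h2).trans (hK k hkK)).mono (add_halves ε).le

theorem mem_tangentCone_iff (h : IsAdmissible c S v) (T : PointedMetricSpace) :
    T ∈ tangentCone (pointedF h) ↔
      ∃ (A : Set E3) (hA : (0 : E3) ∈ A) (α : ℝ) (hα : 0 < α), IsTangentModel S v A ∧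
        T.IsIsometricTo ((ofSet A 0 hA).dilate α hα) :=
  ⟨exists_isTangentModel_of_mem_tangentCone h, fun ⟨_, hA, _, hα, hmod, hT⟩ =>
    mem_tangentCone_of_isTangentModel h hA hα hmod hT⟩

theorem finite_of_mem_tangentCone (h : IsAdmissible c S v) {T : PointedMetricSpace}
    (hT : T ∈ tangentCone (pointedF h)) : Finite T.carrier := by
  obtain ⟨A, hA, α, hα, hmod, e, -⟩ := (mem_tangentCone_iff h T).mp hT
  have := finite_dilate_ofSet hmod.finite_set hA hα
  exact Finite.of_equiv _ e.symm.toEquiv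

theorem tangentCone_nonempty (h : IsAdmissible c S v) : (tangentCone (pointedF h)).Nonempty :=
  ⟨(ofSet {0} (0 : E3) rfl).dilate 1 one_pos, (mem_tangentCone_iff h _).mpr
    ⟨{0}, mem_singleton _, 1, one_pos, .zero, IsometryEquiv.refl _, rfl⟩⟩

end

/-! ### Covering numbers of `F` near the origin -/

section

variable {c : ℝ} {S : ℕ → Finset E3} {v : E3}

/-- The layer `a_n^k S_k` of `F` has `k²` points at mutual distances at least `c a_n^k / k³`. -/
theorem sq_le_openCoveringNumber (h : IsAdmissible c S v) {k n : ℕ} (hk : 1 ≤ k) (hn : 1 ≤ n)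
    {s : ℝ} (hs : 2 * s ≤ radiusSeq k n * (c / (k : ℝ) ^ 3)) {E : Set (setF S)}
    (hE : ∀ w (hw : w ∈ S k), (⟨radiusSeq k n • w, IsAdmissible.smul_mem hk hn hw⟩ : setF S) ∈ E) :
    ((k ^ 2 : ℕ) : ℕ∞) ≤ openCoveringNumber s E := by
  rw [← h.card_eq k hk, ← Finset.card_attach]
  refine card_le_openCoveringNumber _
    (fun w => ⟨radiusSeq k n • w.1, IsAdmissible.smul_mem hk hn w.2⟩)
    (fun w _ => hE w.1 w.2) fun u _ w _ hne => hs.trans ?_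
  change _ ≤ dist (radiusSeq k n • u.1) (radiusSeq k n • w.1)
  rw [dist_smul₀, Real.norm_of_nonneg (radiusSeq_pos k n).le]
  exact mul_le_mul_of_nonneg_left
    (h.separated k hk _ u.2 _ w.2 fun e => hne (Subtype.ext e)) (radiusSeq_pos k n).le

theorem half_le_upperTangentialDim (hc : 0 < c) (h : IsAdmissible c S v) :
    ((1 / 2 : ℝ) : EReal) ≤
      upperTangentialDim (univ : Set (pointedF h).carrier) (pointedF h).pt := by
  -- for large `k`, at the ratio `l = c / (2 k³)`, the closed balls of radii `a_n^k` need at least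
  -- `k² ≥ (1 / l) ^ (1 / 2)` balls
  have hl : Tendsto (fun k : ℕ => c / (2 * (k : ℝ) ^ 3)) atTop (𝓝[>] 0) := by
    refine tendsto_nhdsWithin_iff.mpr ⟨?_, ?_⟩
    · refine Tendsto.const_div_atTop ?_ c
      exact ((tendsto_pow_atTop three_ne_zero).comp tendsto_natCast_atTop_atTop).const_mul_atTop
        two_pos
    · filter_upwards [eventually_ge_atTop 1] with k hk
      have : (0 : ℝ) < k := by exact_mod_cast hk
      exact mem_Ioi.mpr (by positivity)
  refine le_limsup_of_frequently_le (hl.frequently (Eventually.frequently ?_))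
  filter_upwards [eventually_ge_atTop 1, eventually_ge_atTop ⌈2 / c⌉₊, eventually_ge_atTop ⌈c⌉₊]
    with k hk hkc hkc'
  have hk0 : (1 : ℝ) ≤ k := by exact_mod_cast hk
  have hkc : 2 / c ≤ k := Nat.ceil_le.mp hkc
  have hkc' : c ≤ k := Nat.ceil_le.mp hkc'
  have hlog : 0 < Real.log (1 / (c / (2 * (k : ℝ) ^ 3))) := by
    apply Real.log_pos
    rw [one_div_div, lt_div_iff₀ hc]
    linarith [le_self_pow₀ hk0 three_ne_zero]
  have hle : 1 / 2 ≤ Real.log ((k ^ 2 : ℕ) : ℝ) / Real.log (1 / (c / (2 * (k : ℝ) ^ 3))) := by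
    rw [le_div_iff₀ hlog]
    have h1 : Real.log (1 / (c / (2 * (k : ℝ) ^ 3))) ≤ Real.log ((k : ℝ) ^ 4) := by
      apply Real.log_le_log (by positivity)
      rw [one_div_div]
      calc 2 * (k : ℝ) ^ 3 / c = 2 / c * (k : ℝ) ^ 3 := by ring
        _ ≤ k * (k : ℝ) ^ 3 := by gcongr
        _ = (k : ℝ) ^ 4 := by ring
    push_cast
    rw [Real.log_pow] at h1 ⊢
    push_cast at h1 ⊢
    linarith
  have hr : Tendsto (fun n => radiusSeq k n) atTop (𝓝[>] 0) :=
    tendsto_nhdsWithin_iff.mpr ⟨tendsto_radiusSeq k, Eventually.of_forall (radiusSeq_pos k)⟩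
  refine le_limsup_of_frequently_le (hr.frequently (Eventually.frequently ?_))
  filter_upwards [eventually_ge_atTop 1] with n hn
  refine (EReal.coe_le_coe_iff.mpr hle).trans ?_
  rw [EReal.coe_div]
  refine EReal.div_le_div_right_of_nonneg (by exact_mod_cast hlog.le)
    (le_logCovering (by positivity) ?_)
  refine sq_le_openCoveringNumber h hk hn ?_ fun w hw => ⟨mem_univ _, ?_⟩
  · apply le_of_eq
    field_simp
  · change dist (radiusSeq k n • w) 0 ≤ radiusSeq k n
    rw [dist_zero_right, h.norm_smul_eq hk hw]

/-- In a small ball `F` has at most one layer `b S_k` outside a ball of much smaller radius. The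
layer is covered by one ball if `1 / k² < l`, and has at most `1 / l` points otherwise. -/
theorem tangentCompactnessCondition_setF (h : IsAdmissible c S v) :
    TangentCompactnessCondition (pointedF h).pt := by
  classical
  intro l hl
  obtain ⟨ρ, hρ, H⟩ := h.exists_trichotomy (η := l / 2) (by positivity)
  refine (limsup_le_of_le (a := ((⌊1 / l⌋₊ + 2 : ℕ) : ℕ∞)) (h := ?_)).trans_lt
    (ENat.natCast_lt_top _)
  filter_upwards [Ioo_mem_nhdsGT hρ] with r hr
  obtain ⟨hr0 : 0 < r, hrρ : r < ρ⟩ := hr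
  change openCoveringNumber (X := setF S) (l * r) (closedBall ⟨0, h.zero_mem⟩ r) ≤ _
  set o : setF S := ⟨0, h.zero_mem⟩
  have hlr : 0 < l * r := by positivity
  by_cases hall : ∀ x ∈ setF S, ‖x‖ ≤ r → ‖x‖ < l * r
  · refine (openCoveringNumber_le_card {o} ?_).trans
      (Nat.cast_le.mpr ((Finset.card_singleton o).trans_le (by omega)))
    rintro ⟨x, hx⟩ (hxr : dist x 0 ≤ r)
    rw [dist_zero_right] at hxr
    simp only [Finset.mem_singleton, iUnion_iUnion_eq_left]
    change dist x 0 < l * r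
    rw [dist_zero_right]
    exact hall x hx hxr
  · push Not at hall
    obtain ⟨x₀, hx₀, hx₀r, hx₀l⟩ := hall
    rcases h.eq_zero_or_exists_smul hx₀ with rfl | ⟨k, n, hk, hn, w₀, hw₀, rfl⟩
    · rw [norm_zero] at hx₀l
      exact absurd hx₀l hlr.not_ge
    rw [h.norm_smul_eq hk hw₀] at hx₀r hx₀l
    set b := radiusSeq k n with hb
    have hb0 : 0 < b := radiusSeq_pos k n
    have hk0 : (1 : ℝ) ≤ k := by exact_mod_cast hk
    have hcases : ∀ x ∈ setF S, ‖x‖ ≤ r → (∃ w ∈ S k, x = b • w) ∨ dist x 0 < l * r := by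
      intro x hx hxr
      rw [dist_zero_right]
      rcases H k n hk (hx₀r.trans_lt hrρ) x hx with h1 | h1 | h1
      · exact Or.inl h1
      · have : l / 2 * b ≤ l / 2 * r := mul_le_mul_of_nonneg_left hx₀r (by positivity)
        exact Or.inr (by linarith)
      · have : l / 2 * ‖x‖ ≤ l / 2 * r := mul_le_mul_of_nonneg_left hxr (by positivity)
        exfalso
        linarith
    rcases lt_or_ge (1 / (k : ℝ) ^ 2) l with hkl | hkl
    · refine (openCoveringNumber_le_card {o, ⟨b • w₀, hx₀⟩} ?_).trans
        (Nat.cast_le.mpr (Finset.card_le_two.trans (Nat.le_add_left _ _)))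
      rintro ⟨x, hx⟩ (hxr : dist x 0 ≤ r)
      rw [dist_zero_right] at hxr
      rw [mem_iUnion₂]
      rcases hcases x hx hxr with ⟨w, hw, rfl⟩ | h1
      · refine ⟨⟨b • w₀, hx₀⟩, by simp, ?_⟩
        change dist (b • w) (b • w₀) < l * r
        rw [dist_smul₀, Real.norm_of_nonneg hb0.le]
        calc b * dist w w₀ ≤ b * (1 / (k : ℝ) ^ 2) :=
              mul_le_mul_of_nonneg_left (h.dist_le hk hw hw₀) hb0.le
          _ < b * l := mul_lt_mul_of_pos_left hkl hb0
          _ ≤ l * r := by rw [mul_comm]; exact mul_le_mul_of_nonneg_left hx₀r hl.le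
      · exact ⟨o, by simp, h1⟩
    · refine (openCoveringNumber_le_card (insert o ((S k).attach.image fun w =>
        (⟨b • w.1, IsAdmissible.smul_mem hk hn w.2⟩ : setF S))) ?_).trans (Nat.cast_le.mpr ?_)
      · rintro ⟨x, hx⟩ (hxr : dist x 0 ≤ r)
        rw [dist_zero_right] at hxr
        rw [mem_iUnion₂]
        rcases hcases x hx hxr with ⟨w, hw, rfl⟩ | h1
        · refine ⟨⟨b • w, hx⟩, Finset.mem_insert_of_mem (Finset.mem_image.mpr
            ⟨⟨w, hw⟩, Finset.mem_attach _ _, rfl⟩), mem_ball_self hlr⟩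
        · exact ⟨o, by simp, h1⟩
      · refine (Finset.card_insert_le _ _).trans ?_
        have h1 := Finset.card_image_le (s := (S k).attach) (f := fun w =>
          (⟨b • w.1, IsAdmissible.smul_mem hk hn w.2⟩ : setF S))
        rw [Finset.card_attach, h.card_eq k hk] at h1
        have h2 : k ^ 2 ≤ ⌊1 / l⌋₊ := by
          apply Nat.le_floor
          push_cast
          rw [le_div_iff₀ hl]
          rwa [le_div_iff₀ (by positivity), mul_comm] at hkl
        omega

/-- Around a point of the layer `b S_k` the ball of radius `2 b / k²` contains `k²` points which
are separated at the scale `c b / k³`, while the points of `F` in the ball of the same radius around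
the origin lie much closer to it, if `b` is small. -/
theorem not_uniformityAssumption_setF (hc : 0 < c) (h : IsAdmissible c S v) :
    ¬ UniformityAssumption (pointedF h).pt := by
  rintro ⟨c', a, hc', ha, -, H⟩
  obtain ⟨k, hk⟩ := exists_nat_ge (max (max c c') 2)
  have hkc : c ≤ k := (le_max_left _ _).trans ((le_max_left _ _).trans hk)
  have hkc' : c' ≤ k := (le_max_right _ _).trans ((le_max_left _ _).trans hk)
  have hk2 : (2 : ℝ) ≤ k := (le_max_right _ _).trans hk
  have hk1 : 1 ≤ k := by
    have : (1 : ℝ) ≤ k := by linarith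
    exact_mod_cast this
  obtain ⟨η, hη, hη1, hηs⟩ : ∃ η > 0, η ≤ 1 ∧ η < c / (2 * (k : ℝ) ^ 3) := by
    obtain ⟨η, h1, h2⟩ := exists_between (show 0 < min 1 (c / (2 * (k : ℝ) ^ 3)) by positivity)
    exact ⟨η, h1, (h2.trans_le (min_le_left _ _)).le, h2.trans_le (min_le_right _ _)⟩
  obtain ⟨ρ, hρ, Htri⟩ := h.exists_trichotomy hη
  obtain ⟨n, hn, hb⟩ := exists_radiusSeq_lt k (ρ := min ρ (a / 2)) (by positivity)
  set b := radiusSeq k n with hbdef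
  have hb0 : 0 < b := radiusSeq_pos k n
  obtain ⟨w₀, hw₀⟩ := h.nonempty hk1
  have hba : 2 * b ≤ a := by linarith [hb.trans_le (min_le_right _ _)]
  have h4 : (4 : ℝ) ≤ (k : ℝ) ^ 2 := by nlinarith
  have key := H (2 * b) (1 / (k : ℝ) ^ 2) (c / (4 * k)) (by positivity) hba (by positivity)
    (by rw [div_le_one (by positivity)]; linarith) (by positivity)
    (by rw [div_le_one (by positivity)]; linarith)
    (⟨b • w₀, IsAdmissible.smul_mem hk1 hn hw₀⟩ : setF S)
    (by
      change dist (b • w₀) 0 < 2 * b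
      rw [dist_zero_right, h.norm_smul_eq hk1 hw₀]
      linarith)
    (⟨0, h.zero_mem⟩ : setF S)
    (by
      change dist (0 : E3) 0 < 2 * b
      rw [dist_self]
      positivity)
  have hs : 1 / (k : ℝ) ^ 2 * (c / (4 * k)) * (2 * b) = b * (c / (2 * (k : ℝ) ^ 3)) := by
    field_simp
    ring
  have hlower : ((k ^ 2 : ℕ) : ℕ∞) ≤ openCoveringNumber (X := setF S)
      (1 / (k : ℝ) ^ 2 * (c / (4 * k)) * (2 * b))
      (ball ⟨b • w₀, IsAdmissible.smul_mem hk1 hn hw₀⟩ (1 / (k : ℝ) ^ 2 * (2 * b))) := by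
    refine sq_le_openCoveringNumber h hk1 hn ?_ fun w hw => ?_
    · rw [hs, ← hbdef]
      apply le_of_eq
      field_simp
    · change dist (b • w) (b • w₀) < _
      rw [dist_smul₀, Real.norm_of_nonneg hb0.le]
      have h1 := mul_le_mul_of_nonneg_left (h.dist_le hk1 hw hw₀) hb0.le
      have h2 : 0 < b * (1 / (k : ℝ) ^ 2) := by positivity
      linarith
  have hupper : openCoveringNumber (X := setF S)
      (1 / (k : ℝ) ^ 2 * (c / (4 * k)) * (2 * b))
      (ball ⟨0, h.zero_mem⟩ (1 / (k : ℝ) ^ 2 * (2 * b))) ≤ 1 := by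
    refine (openCoveringNumber_le_card {⟨0, h.zero_mem⟩} ?_).trans (by simp)
    rintro ⟨x, hx⟩ (hxr : dist x 0 < 1 / (k : ℝ) ^ 2 * (2 * b))
    simp only [Finset.mem_singleton, iUnion_iUnion_eq_left]
    change dist x 0 < _
    rw [dist_zero_right] at hxr ⊢
    have hxb : ‖x‖ < b := by
      refine hxr.trans_le ?_
      rw [one_div_mul_eq_div, div_le_iff₀ (by positivity)]
      nlinarith
    rw [hs]
    rcases Htri k n hk1 (hb.trans_le (min_le_left _ _)) x hx with ⟨w, hw, rfl⟩ | h1 | h1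
    · rw [h.norm_smul_eq hk1 hw] at hxb
      exact absurd hxb (lt_irrefl _)
    · calc ‖x‖ ≤ η * b := h1
        _ < c / (2 * (k : ℝ) ^ 3) * b := mul_lt_mul_of_pos_right hηs hb0
        _ = _ := mul_comm _ _
    · have := mul_le_mul_of_nonneg_right hη1 (norm_nonneg x)
      linarith
  have hfin : ENNReal.ofReal ((k : ℝ) ^ 2) ≤ ENNReal.ofReal c' := by
    calc ENNReal.ofReal ((k : ℝ) ^ 2) = (((k ^ 2 : ℕ) : ℕ∞) : ℝ≥0∞) := by
          rw [← Nat.cast_pow, ENNReal.ofReal_natCast]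
          rfl
      _ ≤ _ := ENat.toENNReal_le.mpr hlower
      _ ≤ _ := key
      _ ≤ ENNReal.ofReal c' * ((1 : ℕ∞) : ℝ≥0∞) :=
          mul_le_mul_right (ENat.toENNReal_le.mpr hupper) _
      _ = ENNReal.ofReal c' := by simp
  have := (ENNReal.ofReal_le_ofReal_iff (by linarith)).mp hfin
  nlinarith

end

/-! ### Existence of admissible sequences -/

/-- The point of the upper hemisphere above `(x, y)`. -/
noncomputable def hemispherePoint (x y : ℝ) : E3 := !₂[x, y, Real.sqrt (1 - x ^ 2 - y ^ 2)]

theorem dist_hemispherePoint (x y x' y' : ℝ) :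
    dist (hemispherePoint x y) (hemispherePoint x' y') = Real.sqrt ((x - x') ^ 2 + (y - y') ^ 2 +
      (Real.sqrt (1 - x ^ 2 - y ^ 2) - Real.sqrt (1 - x' ^ 2 - y' ^ 2)) ^ 2) := by
  simp [hemispherePoint, EuclideanSpace.dist_eq, Fin.sum_univ_three, Real.dist_eq, sq_abs]

theorem abs_fst_sub_le_dist_hemispherePoint (x y x' y' : ℝ) :
    |x - x'| ≤ dist (hemispherePoint x y) (hemispherePoint x' y') := by
  rw [dist_hemispherePoint]
  apply Real.abs_le_sqrt
  nlinarith [sq_nonneg (y - y'),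
    sq_nonneg (Real.sqrt (1 - x ^ 2 - y ^ 2) - Real.sqrt (1 - x' ^ 2 - y' ^ 2))]

theorem abs_snd_sub_le_dist_hemispherePoint (x y x' y' : ℝ) :
    |y - y'| ≤ dist (hemispherePoint x y) (hemispherePoint x' y') := by
  rw [dist_hemispherePoint]
  apply Real.abs_le_sqrt
  nlinarith [sq_nonneg (x - x'),
    sq_nonneg (Real.sqrt (1 - x ^ 2 - y ^ 2) - Real.sqrt (1 - x' ^ 2 - y' ^ 2))]

theorem hemispherePoint_mem_sphere {x y : ℝ} (h : x ^ 2 + y ^ 2 ≤ 1) :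
    hemispherePoint x y ∈ sphere (0 : E3) 1 := by
  rw [mem_sphere_zero_iff_norm, EuclideanSpace.norm_eq, Real.sqrt_eq_one, Fin.sum_univ_three]
  simp only [hemispherePoint, Real.norm_eq_abs, sq_abs]
  simp [Real.sq_sqrt (show 0 ≤ 1 - x ^ 2 - y ^ 2 by linarith)]

/-- The height of the hemisphere is Lipschitz where it is at least `1 / 2`. -/
theorem dist_hemispherePoint_le {x y x' y' e : ℝ} (hx : 0 ≤ x) (hy : 0 ≤ y) (hx' : 0 ≤ x')
    (hy' : 0 ≤ y') (hx1 : x ≤ 5 / 8) (hy1 : y ≤ 1 / 8) (hx1' : x' ≤ 5 / 8) (hy1' : y' ≤ 1 / 8)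
    (hex : |x - x'| ≤ e) (hey : |y - y'| ≤ e) :
    dist (hemispherePoint x y) (hemispherePoint x' y') ≤ 8 * e := by
  have he : 0 ≤ e := (abs_nonneg _).trans hex
  rw [dist_hemispherePoint]
  have hz : ∀ x y : ℝ, 0 ≤ x → 0 ≤ y → x ≤ 5 / 8 → y ≤ 1 / 8 →
      1 / 2 ≤ Real.sqrt (1 - x ^ 2 - y ^ 2) ∧
        Real.sqrt (1 - x ^ 2 - y ^ 2) ^ 2 = 1 - x ^ 2 - y ^ 2 := by
    intro x y h1 h2 h3 h4
    have : 1 / 4 ≤ 1 - x ^ 2 - y ^ 2 := by nlinarith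
    exact ⟨Real.le_sqrt_of_sq_le (by linarith), Real.sq_sqrt (by linarith)⟩
  obtain ⟨z1, z2⟩ := hz x y hx hy hx1 hy1
  obtain ⟨z1', z2'⟩ := hz x' y' hx' hy' hx1' hy1'
  set z := Real.sqrt (1 - x ^ 2 - y ^ 2)
  set z' := Real.sqrt (1 - x' ^ 2 - y' ^ 2)
  have hdiff : |z - z'| ≤ 4 * e := by
    have h1 : (z - z') * (z + z') = -((x - x') * (x + x')) - (y - y') * (y + y') := by
      linear_combination z2 - z2'
    have h2 : |z - z'| * (z + z') ≤ |x - x'| * (x + x') + |y - y'| * (y + y') := by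
      rw [← abs_of_nonneg (show 0 ≤ z + z' by linarith), ← abs_mul, h1,
        ← abs_of_nonneg (add_nonneg hx hx'), ← abs_of_nonneg (add_nonneg hy hy'), ← abs_mul,
        ← abs_mul, ← abs_neg ((x - x') * (x + x'))]
      simpa only [abs_abs, abs_of_nonneg (add_nonneg hx hx'), abs_of_nonneg (add_nonneg hy hy')]
        using abs_sub (-((x - x') * (x + x'))) ((y - y') * (y + y'))
    have h3 : |z - z'| * 1 ≤ |z - z'| * (z + z') :=
      mul_le_mul_of_nonneg_left (by linarith) (abs_nonneg _)
    have h4 : |x - x'| * (x + x') ≤ e * 2 := mul_le_mul hex (by linarith) (by linarith) he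
    have h5 : |y - y'| * (y + y') ≤ e * 2 := mul_le_mul hey (by linarith) (by linarith) he
    linarith
  apply Real.sqrt_le_iff.mpr ⟨by positivity, ?_⟩
  have s1 := sq_le_sq.mpr (hex.trans_eq (abs_of_nonneg he).symm)
  have s2 := sq_le_sq.mpr (hey.trans_eq (abs_of_nonneg he).symm)
  have s3 := sq_le_sq.mpr (hdiff.trans_eq (abs_of_nonneg (by positivity : 0 ≤ 4 * e)).symm)
  nlinarith [sq_nonneg e]

/-- The point of the hemisphere above the node `(i, j)` of a square grid of mesh `1 / (8 k³)`
whose corner is `(1 / (2 k), 0)`. -/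
noncomputable def gridPoint (k i j : ℕ) : E3 :=
  hemispherePoint (1 / (2 * k) + i / (8 * (k : ℝ) ^ 3)) (j / (8 * (k : ℝ) ^ 3))

/-- The points of the hemisphere above the `k × k` grid of mesh `1 / (8 k³)` with corner
`(1 / (2 k), 0)`. The mesh makes the diameter of order `1 / k²`, and the gap between the corners for
`k` and `k + 1` is of the same order. -/
noncomputable def gridSet (k : ℕ) : Finset E3 :=
  open Classical in
  (Finset.range k ×ˢ Finset.range k).image fun p => gridPoint k p.1 p.2

theorem mem_gridSet {k : ℕ} {u : E3} :
    u ∈ gridSet k ↔ ∃ i < k, ∃ j < k, gridPoint k i j = u := by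
  simp only [gridSet, Finset.mem_image, Finset.mem_product, Finset.mem_range, Prod.exists]
  constructor
  · rintro ⟨i, j, ⟨hi, hj⟩, rfl⟩
    exact ⟨i, hi, j, hj, rfl⟩
  · rintro ⟨i, hi, j, hj, rfl⟩
    exact ⟨i, j, ⟨hi, hj⟩, rfl⟩

theorem natCast_div_eight_mul_pow_le {k i : ℕ} (hi : i < k) :
    (i : ℝ) / (8 * (k : ℝ) ^ 3) ≤ 1 / (8 * (k : ℝ) ^ 2) := by
  have hk : (0 : ℝ) < k := by exact_mod_cast (Nat.zero_le i).trans_lt hi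
  have hik : (i : ℝ) ≤ k := by exact_mod_cast hi.le
  rw [div_le_div_iff₀ (by positivity) (by positivity)]
  calc (i : ℝ) * (8 * (k : ℝ) ^ 2) ≤ k * (8 * (k : ℝ) ^ 2) := by gcongr
    _ = 1 * (8 * (k : ℝ) ^ 3) := by ring

theorem one_div_eight_mul_sq_le {k : ℕ} (hk : 1 ≤ k) :
    1 / (8 * (k : ℝ) ^ 2) ≤ 1 / (8 * (k : ℝ)) := by
  have hk0 : (1 : ℝ) ≤ k := by exact_mod_cast hk
  apply one_div_le_one_div_of_le (by positivity)
  nlinarith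

theorem le_abs_natCast_sub_div {k i i' : ℕ} (hk : 1 ≤ k) (hne : i ≠ i') :
    1 / 8 / (k : ℝ) ^ 3 ≤ |(i : ℝ) / (8 * (k : ℝ) ^ 3) - i' / (8 * (k : ℝ) ^ 3)| := by
  have hk0 : (0 : ℝ) < k := by exact_mod_cast hk
  have h1 : (1 : ℝ) ≤ |(i : ℝ) - i'| := by
    have : (1 : ℤ) ≤ |(i : ℤ) - i'| := Int.one_le_abs (sub_ne_zero.mpr (by exact_mod_cast hne))
    exact_mod_cast this
  rw [← sub_div, abs_div, abs_of_pos (show 0 < 8 * (k : ℝ) ^ 3 by positivity), div_div]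
  gcongr

theorem le_dist_gridPoint {k i j i' j' : ℕ} (hk : 1 ≤ k) (hne : i ≠ i' ∨ j ≠ j') :
    1 / 8 / (k : ℝ) ^ 3 ≤ dist (gridPoint k i j) (gridPoint k i' j') := by
  rcases hne with hne | hne
  · refine (le_abs_natCast_sub_div hk hne).trans ?_
    rw [← add_sub_add_left_eq_sub _ _ (1 / (2 * (k : ℝ)))]
    exact abs_fst_sub_le_dist_hemispherePoint _ _ _ _
  · exact (le_abs_natCast_sub_div hk hne).trans (abs_snd_sub_le_dist_hemispherePoint _ _ _ _)

theorem exists_isAdmissible : ∃ c : ℝ, 0 < c ∧ ∃ (S : ℕ → Finset E3) (v : E3),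
    IsAdmissible c S v := by
  -- bounds for the coordinates of the grid
  have hcoord : ∀ {k i : ℕ}, 1 ≤ k → i < k → 0 ≤ (i : ℝ) / (8 * (k : ℝ) ^ 3) ∧
      (i : ℝ) / (8 * (k : ℝ) ^ 3) ≤ 1 / 8 ∧ 0 ≤ 1 / (2 * (k : ℝ)) + i / (8 * (k : ℝ) ^ 3) ∧
      1 / (2 * (k : ℝ)) + i / (8 * (k : ℝ) ^ 3) ≤ 5 / 8 := by
    intro k i hk hi
    have hk0 : (1 : ℝ) ≤ k := by exact_mod_cast hk
    have h1 : 1 / (8 * (k : ℝ)) ≤ 1 / 8 := one_div_le_one_div_of_le (by norm_num) (by linarith)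
    have h2 : 1 / (2 * (k : ℝ)) ≤ 1 / 2 := one_div_le_one_div_of_le (by norm_num) (by linarith)
    have h3 := (natCast_div_eight_mul_pow_le hi).trans (one_div_eight_mul_sq_le hk)
    have h4 : 0 ≤ (i : ℝ) / (8 * (k : ℝ) ^ 3) := by positivity
    have h5 : 0 ≤ 1 / (2 * (k : ℝ)) := by positivity
    exact ⟨h4, by linarith, by linarith, by linarith⟩
  refine ⟨1 / 8, by norm_num, gridSet, hemispherePoint 0 0, ?_, ?_, ?_, ?_, ?_, ?_, ?_⟩
  · intro k hk u hu
    obtain ⟨i, hi, j, hj, rfl⟩ := mem_gridSet.mp hu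
    obtain ⟨-, -, hx0, hx1⟩ := hcoord hk hi
    obtain ⟨hy0, hy1, -, -⟩ := hcoord hk hj
    exact hemispherePoint_mem_sphere (by nlinarith)
  · intro k hk
    rw [gridSet, Finset.card_image_of_injOn, Finset.card_product, Finset.card_range, sq]
    rintro ⟨i, j⟩ - ⟨i', j'⟩ - (heq : gridPoint k i j = gridPoint k i' j')
    by_contra hne
    have h1 := le_dist_gridPoint (i := i) (i' := i') (j := j) (j' := j') hk (by
      by_contra! hcon
      exact hne (Prod.ext hcon.1 hcon.2))
    have hk0 : (0 : ℝ) < k := by exact_mod_cast hk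
    rw [heq, dist_self] at h1
    exact absurd h1 (not_le.mpr (by positivity))
  · intro k hk
    refine diam_le_of_forall_dist_le (by positivity) fun u hu w hw => ?_
    obtain ⟨i, hi, j, hj, rfl⟩ := mem_gridSet.mp hu
    obtain ⟨i', hi', j', hj', rfl⟩ := mem_gridSet.mp hw
    obtain ⟨hi0, -, hx0, hx1⟩ := hcoord hk hi
    obtain ⟨hy0, hy1, -, -⟩ := hcoord hk hj
    obtain ⟨hi0', -, hx0', hx1'⟩ := hcoord hk hi'
    obtain ⟨hy0', hy1', -, -⟩ := hcoord hk hj'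
    have e1 := natCast_div_eight_mul_pow_le hi
    have e2 := natCast_div_eight_mul_pow_le hj
    have e3 := natCast_div_eight_mul_pow_le hi'
    have e4 := natCast_div_eight_mul_pow_le hj'
    refine (dist_hemispherePoint_le (e := 1 / (8 * (k : ℝ) ^ 2)) hx0 hy0 hx0' hy0' hx1 hy1 hx1'
      hy1' ?_ ?_).trans_eq ?_
    · rw [abs_le]
      constructor <;> linarith
    · rw [abs_le]
      constructor <;> linarith
    · have hk0 : (k : ℝ) ≠ 0 := by positivity
      field_simp
  · intro k hk u hu w hw hne
    obtain ⟨i, hi, j, hj, rfl⟩ := mem_gridSet.mp hu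
    obtain ⟨i', hi', j', hj', rfl⟩ := mem_gridSet.mp hw
    refine le_dist_gridPoint hk ?_
    by_contra! hcon
    exact hne (by rw [hcon.1, hcon.2])
  · -- the first coordinates differ by at least `1 / (2 k) - 1 / (2 h) - 1 / (8 h²)`
    intro k m hk hkm u hu w hw
    obtain ⟨i, hi, j, hj, rfl⟩ := mem_gridSet.mp hu
    obtain ⟨i', hi', j', hj', rfl⟩ := mem_gridSet.mp hw
    refine le_trans ?_ ((le_abs_self _).trans (abs_fst_sub_le_dist_hemispherePoint _ _ _ _))
    have e1 := (hcoord hk hi).1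
    have e2 := natCast_div_eight_mul_pow_le hi'
    have hk0 : (1 : ℝ) ≤ k := by exact_mod_cast hk
    have hkm' : (k : ℝ) + 1 ≤ m := by exact_mod_cast hkm
    have e3 : 1 / (2 * (m : ℝ)) ≤ 1 / (2 * ((k : ℝ) + 1)) :=
      one_div_le_one_div_of_le (by positivity) (by linarith)
    have e4 : 1 / (8 * (m : ℝ) ^ 2) ≤ 1 / (8 * (k : ℝ) ^ 2) :=
      one_div_le_one_div_of_le (by positivity) (by gcongr)
    have e5 : 1 / 8 / (k : ℝ) ^ 3 ≤ 1 / (8 * (k : ℝ) ^ 2) := by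
      rw [div_div]
      exact one_div_le_one_div_of_le (by positivity)
        (mul_le_mul_of_nonneg_left (pow_le_pow_right₀ hk0 (by norm_num)) (by norm_num))
    have e6 : 1 / (8 * (k : ℝ) ^ 2) + 1 / (8 * (k : ℝ) ^ 2) ≤
        1 / (2 * (k : ℝ)) - 1 / (2 * ((k : ℝ) + 1)) := by
      have : 1 / (2 * (k : ℝ)) - 1 / (2 * ((k : ℝ) + 1)) = 1 / (2 * k * (k + 1)) := by
        field_simp
        ring
      rw [this, ← two_mul, mul_one_div, div_le_div_iff₀ (by positivity) (by positivity)]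
      nlinarith
    linarith
  · exact hemispherePoint_mem_sphere (by norm_num)
  · have hbound : Tendsto (fun k : ℕ => 8 * (5 / 8 * (1 / (k : ℝ)))) atTop (𝓝 0) := by
      have := (tendsto_one_div_atTop_nhds_zero_nat (𝕜 := ℝ)).const_mul (5 / 8) |>.const_mul 8
      simpa using this
    refine squeeze_zero' (Eventually.of_forall fun _ => hausdorffDist_nonneg) ?_ hbound
    filter_upwards [eventually_ge_atTop 1] with k hk
    have hd : ∀ u ∈ gridSet k, dist u (hemispherePoint 0 0) ≤ 8 * (5 / 8 * (1 / (k : ℝ))) := by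
      intro u hu
      obtain ⟨i, hi, j, hj, rfl⟩ := mem_gridSet.mp hu
      obtain ⟨hi0, -, hx0, hx1⟩ := hcoord hk hi
      obtain ⟨hy0, hy1, -, -⟩ := hcoord hk hj
      have e1 := (natCast_div_eight_mul_pow_le hi).trans (one_div_eight_mul_sq_le hk)
      have e2 := (natCast_div_eight_mul_pow_le hj).trans (one_div_eight_mul_sq_le hk)
      have e3 : 1 / (2 * (k : ℝ)) = 1 / 2 * (1 / k) := by rw [one_div_mul_one_div]
      have e4 : 1 / (8 * (k : ℝ)) = 1 / 8 * (1 / k) := by rw [one_div_mul_one_div]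
      have e5 : 0 ≤ 1 / (k : ℝ) := by positivity
      refine dist_hemispherePoint_le hx0 hy0 le_rfl le_rfl hx1 hy1 (by norm_num) (by norm_num)
        ?_ ?_
      · rw [sub_zero, abs_of_nonneg hx0]
        linarith
      · rw [sub_zero, abs_of_nonneg hy0]
        linarith
    have hne : (gridSet k).Nonempty := ⟨gridPoint k 0 0, mem_gridSet.mpr ⟨0, hk, 0, hk, rfl⟩⟩
    refine hausdorffDist_le_of_mem_dist (by positivity) (fun u hu => ⟨_, rfl, hd u hu⟩) ?_
    rintro _ rfl
    obtain ⟨u, hu⟩ := hne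
    exact ⟨u, hu, by rw [dist_comm]; exact hd u hu⟩

/-! ### Dimensions of the tangent sets and of `F` -/

/-- A dimension vanishing on all tangent sets has supremum zero; the tangent cone contains `{0}`, so
that the supremum is not that of the empty set. -/
theorem sSup_image_tangentCone_eq_zero {c : ℝ} {S : ℕ → Finset E3} {v : E3}
    (h : IsAdmissible c S v) {f : PointedMetricSpace → EReal}
    (hf : ∀ T ∈ tangentCone (pointedF h), f T = 0) : sSup (f '' tangentCone (pointedF h)) = 0 := by
  rw [image_congr hf, (tangentCone_nonempty h).image_const, sSup_singleton]

theorem mainTheorem3 :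
    (∃ c : ℝ, 0 < c ∧ ∃ (S : ℕ → Finset E3) (v : E3), IsAdmissible c S v) ∧
    ∀ (c : ℝ), 0 < c → ∀ (S : ℕ → Finset E3) (v : E3) (h : IsAdmissible c S v),
      -- the tangent sets at `0`, up to isometry and dilation
      (∀ T : PointedMetricSpace, T ∈ tangentCone (pointedF h) ↔
        ∃ (A : Set E3) (hA : (0 : E3) ∈ A) (α : ℝ) (hα : 0 < α), IsTangentModel S v A ∧
          T.IsIsometricTo ((PointedMetricSpace.ofSet A 0 hA).dilate α hα)) ∧
      -- all of them are zero-dimensional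
      (∀ T ∈ tangentCone (pointedF h), lowerBoxDim T.pt = 0 ∧ upperBoxDim T.pt = 0) ∧
      sSup ((fun T => lowerBoxDim T.pt) '' tangentCone (pointedF h)) = 0 ∧
      sSup ((fun T => upperBoxDim T.pt) '' tangentCone (pointedF h)) = 0 ∧
      -- the upper tangential dimension is strictly larger
      ((1 / 2 : ℝ) : EReal) ≤
        upperTangentialDim (univ : Set (pointedF h).carrier) (pointedF h).pt ∧
      sSup ((fun T => upperBoxDim T.pt) '' tangentCone (pointedF h)) <
        upperTangentialDim (univ : Set (pointedF h).carrier) (pointedF h).pt ∧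
      -- the compactness condition holds and the uniformity assumption fails
      TangentCompactnessCondition (pointedF h).pt ∧
      ¬ UniformityAssumption (pointedF h).pt := by
  refine ⟨exists_isAdmissible, fun c hc S v h => ?_⟩
  have hdim : ∀ T ∈ tangentCone (pointedF h), lowerBoxDim T.pt = 0 ∧ upperBoxDim T.pt = 0 := by
    intro T hT
    have := finite_of_mem_tangentCone h hT
    exact ⟨lowerBoxDim_of_finite _, upperBoxDim_of_finite _⟩
  have hup := sSup_image_tangentCone_eq_zero h fun T hT => (hdim T hT).2
  have hhalf := half_le_upperTangentialDim hc h
  refine ⟨mem_tangentCone_iff h, hdim,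
    sSup_image_tangentCone_eq_zero h fun T hT => (hdim T hT).1, hup, hhalf, ?_,
    tangentCompactnessCondition_setF h, not_uniformityAssumption_setF hc h⟩
  rw [hup]
  refine lt_of_lt_of_le ?_ hhalf
  exact_mod_cast (by norm_num : (0 : ℝ) < 1 / 2)
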